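/- \textbf{Setting.} The Aztec diamond of order $n$ is the union of the unit cells $[a,a+1]\times[b,b+1]$, $(a,b)\in\mathbb Z^2$, with $|a+\tfrac12|+|b+\tfrac12|\le n$. A configuration $c$ is a tiling of it by dominos ($2\times1$ or $1\times 2$ rectangles made of two cells). Fix $\lambda>0$. Horizontal dominos have weight $1$ and vertical dominos weight $\sqrt\lambda$, so that $c$ has weight $w(c)=\lambda^{N_v(c)/2}$, where $N_v(c)$ is the number of vertical dominos; the biased measure is $\mathbb P(c)=w(c)/Z_n$ with $Z_n=\sum_c w(c)$. For $1\le\ell\le n$ and $0\le k\le n$ consider the cell with lower left corner $(k+\ell-1-n,\;k-\ell)$. There is a particle on level $\ell$ at height $k$ if this cell is the left cell of a horizontal domino or the upper cell of a vertical domino of the configuration. Level $\ell$ carries $\ell$ particles, whose heights are denoted $x_1^{(\ell)}<\dots<x_\ell^{(\ell)}$. Set $$z_i^{(\ell)}=\frac{x_i^{(\ell)}-\mu}{\sigma},\qquad \mu=\frac{n\lambda}{1+\lambda},\qquad \sigma^2=\frac{n\lambda}{(1+\lambda)^2}\quad(\sigma>0).$$ For $m\in\mathbb N$, the GUE-corners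 process with $m$ levels is the random triangular array $(z_i^{(\ell)})_{1\le i\le\ell\le m}$ of real numbers with joint density, with respect to Lebesgue measure on $\mathbb R^{m(m+1)/2}$, $$\rho_{\text{GUE-corners}}(z^{(1)},\dots,z^{(m)})=\frac{1}{(2\pi)^{m/2}}\prod_{1\le i<j\le m}\bigl(z_j^{(m)}-z_i^{(m)}\bigr)\prod_{i=1}^m e^{-\frac12 (z_i^{(m)})^2}\;\chi(z^{(1)}\prec\dots\prec z^{(m)}),$$ where $\chi$ is $1$ if $z_i^{(\ell)}<z_{i+1}^{(\ell)}$ for $1\le i<\ell\le m$ and $z_i^{(\ell+1)}\le z_i^{(\ell)}\le z_{i+1}^{(\ell+1)}$ for $1\le i\le\ell<m$, and $0$ otherwise. \textbf{Proposition.} For every $\lambda>0$ and every fixed $m$, the function $\rho_{\text{GUE-corners}}$ is a probability density, and, as $n\to\infty$, the joint law under the biased measure of the rescaled particles $(z_i^{(\ell)})_{1\le i\le\ell\le m}$ on the first $m$ levels converges in distribution (weakly) to the law with density $\rho_{\text{GUE-corners}}$. -/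

import Mathlib

open MeasureTheory ProbabilityTheory Filter Topology

namespace AztecDiamond

/-! ### Domino tilings of the Aztec diamond -/

/-- A unit cell `[a, a+1] × [b, b+1]` of the square grid, given by its lower left corner `(a, b)`. -/
abbrev Cell : Type := ℤ × ℤ

/-- A domino, given by its lower left cell and its orientation: `(c, false)` is the horizontal and
`(c, true)` the vertical domino whose lower left cell is `c`. -/
abbrev Domino : Type := Cell × Bool

/-- The horizontal domino covering `c` and its right neighbour. -/
abbrev hDomino (c : Cell) : Domino := (c, false)

/-- The vertical domino covering `c` and its upper neighbour. -/
abbrev vDomino (c : Cell) : Domino := (c, true)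

/-- The two cells covered by a domino. -/
def Domino.cells (d : Domino) : Finset Cell :=
  if d.2 then {d.1, (d.1.1, d.1.2 + 1)} else {d.1, (d.1.1 + 1, d.1.2)}

/-- The Aztec diamond of order `n`: the cells whose centre `(a + 1/2, b + 1/2)` satisfies
`|a + 1/2| + |b + 1/2| ≤ n`. -/
noncomputable def region (n : ℕ) : Finset Cell :=
  (Finset.Icc (-(n : ℤ)) n ×ˢ Finset.Icc (-(n : ℤ)) n).filter
    fun c => (2 * c.1 + 1).natAbs + (2 * c.2 + 1).natAbs ≤ 2 * n

/-- The dominos that lie inside the Aztec diamond of order `n`. -/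
noncomputable def dominos (n : ℕ) : Finset Domino :=
  (region n ×ˢ Finset.univ).filter fun d => Domino.cells d ⊆ region n

/-- The configurations: sets of dominos inside the Aztec diamond of order `n` such that every cell
of the diamond is covered by exactly one of them. -/
noncomputable def tilings (n : ℕ) : Finset (Finset Domino) :=
  (dominos n).powerset.filter
    fun T => ∀ c ∈ region n, (T.filter fun d => c ∈ Domino.cells d).card = 1

/-! ### The biased measure -/

/-- The number `N_v` of vertical dominos. -/
def numVertical (T : Finset Domino) : ℕ := (T.filter fun d => d.2 = true).card

/-- The weight of a configuration: vertical dominos have weight `√lam`, horizontal ones `1`. -/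
noncomputable def weight (lam : ℝ) (T : Finset Domino) : ℝ := Real.sqrt lam ^ numVertical T

/-- The partition function `Z_n`. -/
noncomputable def partitionFunction (lam : ℝ) (n : ℕ) : ℝ := ∑ T ∈ tilings n, weight lam T

theorem weight_nonneg (lam : ℝ) (T : Finset Domino) : 0 ≤ weight lam T :=
  pow_nonneg (Real.sqrt_nonneg _) _

/-- The tiling by horizontal dominos only. -/
noncomputable def horizontalTiling (n : ℕ) : Finset Domino :=
  (dominos n).filter fun d => d.2 = false ∧ 2 ∣ d.1.1 + n + ((2 * d.1.2 + 1).natAbs - 1) / 2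

theorem mem_region {n : ℕ} {a b : ℤ} :
    (a, b) ∈ region n ↔ (2 * a + 1).natAbs + (2 * b + 1).natAbs ≤ 2 * n := by
  simp only [region, Finset.mem_filter, Finset.mem_product, Finset.mem_Icc, and_iff_right_iff_imp]
  intro h
  omega

theorem mem_horizontalTiling {n : ℕ} {a b : ℤ} {v : Bool} :
    ((a, b), v) ∈ horizontalTiling n ↔ (a, b) ∈ region n ∧ (a + 1, b) ∈ region n ∧ v = false ∧
      2 ∣ a + n + ((2 * b + 1).natAbs - 1) / 2 := by
  simp only [horizontalTiling, dominos, Finset.mem_filter, Finset.mem_product, Finset.mem_univ,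
    and_true]
  cases v <;> simp [Domino.cells, Finset.insert_subset_iff]
  tauto

theorem horizontalTiling_mem (n : ℕ) : horizontalTiling n ∈ tilings n := by
  rw [tilings, Finset.mem_filter, Finset.mem_powerset]
  refine ⟨Finset.filter_subset _ _, ?_⟩
  rintro ⟨a, b⟩ hc
  rw [Finset.card_eq_one]
  rw [mem_region] at hc
  by_cases hp : 2 ∣ a + n + ((2 * b + 1).natAbs - 1) / 2
  · refine ⟨((a, b), false), ?_⟩
    ext ⟨⟨a', b'⟩, v⟩
    simp only [Finset.mem_filter, mem_horizontalTiling, Finset.mem_singleton, mem_region]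
    simp only [Domino.cells, Prod.mk.injEq]
    constructor
    · rintro ⟨⟨h1, h2, rfl, h4⟩, h5⟩
      simp only [Bool.false_eq_true, if_false, Finset.mem_insert, Finset.mem_singleton,
        Prod.mk.injEq] at h5
      rcases h5 with ⟨rfl, rfl⟩ | ⟨rfl, rfl⟩
      · simp
      · omega
    · rintro ⟨⟨rfl, rfl⟩, rfl⟩
      refine ⟨⟨hc, ?_, rfl, hp⟩, by simp⟩
      omega
  · refine ⟨((a - 1, b), false), ?_⟩
    ext ⟨⟨a', b'⟩, v⟩
    simp only [Finset.mem_filter, mem_horizontalTiling, Finset.mem_singleton, mem_region]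
    simp only [Domino.cells, Prod.mk.injEq]
    constructor
    · rintro ⟨⟨h1, h2, rfl, h4⟩, h5⟩
      simp only [Bool.false_eq_true, if_false, Finset.mem_insert, Finset.mem_singleton,
        Prod.mk.injEq] at h5
      rcases h5 with ⟨rfl, rfl⟩ | ⟨rfl, rfl⟩
      · omega
      · simp
    · rintro ⟨⟨rfl, rfl⟩, rfl⟩
      refine ⟨⟨?_, by simpa using hc, rfl, by omega⟩, by simp⟩
      omega

theorem partitionFunction_pos (lam : ℝ) (n : ℕ) : 0 < partitionFunction lam n := by
  refine Finset.sum_pos' (fun T _ => weight_nonneg lam T)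
    ⟨horizontalTiling n, horizontalTiling_mem n, ?_⟩
  have h : numVertical (horizontalTiling n) = 0 := by
    rw [numVertical, Finset.card_eq_zero, Finset.filter_eq_empty_iff]
    rintro ⟨⟨a, b⟩, v⟩ hd
    rw [mem_horizontalTiling] at hd
    simp [hd.2.2.1]
  simp [weight, h]

instance : MeasurableSpace (Finset Domino) := ⊤

/-- The biased probability distribution `ℙ(c) = w(c) / Z_n` on configurations. -/
noncomputable def biasedPMF (lam : ℝ) (n : ℕ) : PMF (Finset Domino) :=
  PMF.ofFinset
    (fun T => if T ∈ tilings n then ENNReal.ofReal (weight lam T / partitionFunction lam n) else 0)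
    (tilings n)
    (by
      rw [Finset.sum_congr rfl fun T hT => if_pos hT, ← ENNReal.ofReal_sum_of_nonneg
        fun T _ => div_nonneg (weight_nonneg lam T) (partitionFunction_pos lam n).le,
        ← Finset.sum_div, ← partitionFunction, div_self (partitionFunction_pos lam n).ne',
        ENNReal.ofReal_one])
    (fun T hT => if_neg hT)

/-- The biased probability measure on the configurations of the Aztec diamond of order `n`. -/
noncomputable def biasedMeasure (lam : ℝ) (n : ℕ) : Measure (Finset Domino) :=
  (biasedPMF lam n).toMeasure

instance (lam : ℝ) (n : ℕ) : IsProbabilityMeasure (biasedMeasure lam n) :=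
  inferInstanceAs (IsProbabilityMeasure (biasedPMF lam n).toMeasure)

/-! ### The particle system -/

/-- The cell on the lines `ℓ` and `k`, where `1 ≤ ℓ ≤ n` and `0 ≤ k ≤ n`: the line `ℓ` consists of
the points with `x - y = 2 ℓ - 1 - n` and the line `k` of those with `x + y = 2 k - n`, and they
meet at the centre of this cell. -/
def gridCell (n ℓ k : ℕ) : Cell := ((k : ℤ) + ℓ - 1 - n, (k : ℤ) - ℓ)

/-- There is a particle on level `ℓ` at height `k` if, after the rotation by 45° (counterclockwise)
that makes the lines `ℓ` vertical, the cell there is the left part of its domino, i.e. if it is the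
left cell of a horizontal or the upper cell of a vertical domino. -/
def HasParticle (n : ℕ) (T : Finset Domino) (ℓ k : ℕ) : Prop :=
  k ≤ n ∧ (hDomino (gridCell n ℓ k) ∈ T ∨
    vDomino ((gridCell n ℓ k).1, (gridCell n ℓ k).2 - 1) ∈ T)

/-- `particle n T ℓ i` is the height of the `i`-th lowest particle on level `ℓ`, counting from
`i = 0`. -/
noncomputable def particle (n : ℕ) (T : Finset Domino) (ℓ i : ℕ) : ℕ :=
  Nat.nth (HasParticle n T ℓ) i

end AztecDiamond

/-! ### Triangular arrays and the GUE-corners process -/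

/-- Triangular arrays `z_i^{(ℓ)}`, `1 ≤ i ≤ ℓ ≤ m`. Both indices are shifted by one: the entry
`z ⟨ℓ, i⟩` is `z_{i+1}^{(ℓ+1)}`. -/
abbrev TriArray (m : ℕ) : Type := (Σ ℓ : Fin m, Fin (ℓ.val + 1)) → ℝ

namespace TriArray

/-- The entry `z_{i+1}^{(ℓ+1)}`. -/
def entry {m : ℕ} (z : TriArray m) (ℓ i : ℕ) (hℓ : ℓ < m) (hi : i < ℓ + 1) : ℝ :=
  z ⟨⟨ℓ, hℓ⟩, ⟨i, hi⟩⟩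

/-- The last level `z^{(m)}`. -/
def lastLevel {m : ℕ} (z : TriArray m) (i : Fin m) : ℝ :=
  z.entry (m - 1) i (by have := i.isLt; omega) (by have := i.isLt; omega)

/-- The relation `z^{(1)} ≺ ⋯ ≺ z^{(m)}`: every level is strictly increasing and consecutive levels
interlace. -/
def Interlaced {m : ℕ} (z : TriArray m) : Prop :=
  (∀ (ℓ i : ℕ) (hℓ : ℓ < m) (hi : i + 1 < ℓ + 1),
    z.entry ℓ i hℓ (by omega) < z.entry ℓ (i + 1) hℓ hi) ∧
  ∀ (ℓ i : ℕ) (hℓ : ℓ + 1 < m) (hi : i < ℓ + 1),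
    z.entry (ℓ + 1) i hℓ (by omega) ≤ z.entry ℓ i (by omega) hi ∧
    z.entry ℓ i (by omega) hi ≤ z.entry (ℓ + 1) (i + 1) hℓ (by omega)

end TriArray

open Classical in
/-- The joint density of the GUE-corners process with `m` levels; the Vandermonde determinant of
the last level is `∏_{i<j} (z_j^{(m)} - z_i^{(m)})`. -/
noncomputable def gueCornersDensity (m : ℕ) (z : TriArray m) : ℝ :=
  if z.Interlaced then
    1 / (2 * Real.pi) ^ ((m : ℝ) / 2) * (Matrix.vandermonde z.lastLevel).det *
      ∏ i : Fin m, Real.exp (-(1 / 2) * z.lastLevel i ^ 2)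
  else 0

/-- The law of the GUE-corners process with `m` levels. -/
noncomputable def gueCorners (m : ℕ) : Measure (TriArray m) :=
  volume.withDensity fun z => ENNReal.ofReal (gueCornersDensity m z)

/-- The rescaled particles `z_i^{(ℓ)} = (x_i^{(ℓ)} - μ) / σ` on the levels `1, …, m`, where
`μ = n lam / (1 + lam)` and `σ² = n lam / (1 + lam)²`. -/
noncomputable def rescaledParticles (lam : ℝ) (m n : ℕ) (T : Finset AztecDiamond.Domino) :
    TriArray m :=
  fun p => ((AztecDiamond.particle n T (p.1 + 1) p.2 : ℝ) - n * lam / (1 + lam)) /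
    Real.sqrt (n * lam / (1 + lam) ^ 2)

/-!
# The GUE-corners limit of the biased Aztec diamond

The proof determines the law of the particles exactly, shows that it has a local limit, and
deduces weak convergence.

*Tilings as particle arrays.* The Aztec diamond is a bipartite graph whose one colour class consists
of the cells `gridCell n ℓ k`. Counting the cells of the other colour line by line shows that the
particle sets of consecutive levels interlace (`cnt_succ_level`), and that a tiling is determined by
its particles and by the set of those whose domino goes down (`tilingOf`, `downSet`). Half of the
vertical dominos carry a particle in their upper cell (`sum_ind_eq`), so the weight of a tiling is
`lam` to the number of particles that go down. Hence the total weight of the tilings with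
given particles is a product of factors `interlaceWeight`, one for each particle
(`sum_weight_agrees`).

*Exact law of the first levels.* Let `K m` be the Vandermonde determinant of level `m` times the
product of the binomial weights `lam ^ y * choose n y`. Summing the interlacing weights times
`K (m + 1)` over level `m + 1` gives a constant times `K m` (`sum_interlaceWeight_mul`): the sum is
over boxes of a determinant whose entries have explicit discrete antiderivatives. The full level
`n + 1` starts a downward induction, at the end of which the probability of given first `m` levels
is the product of their interlacing weights times `K m`, up to an explicit constant
(`cylinderWeight_mul`).

*Local limit.* By Stirling's formula the binomial weights have the Gaussian as local limit
(`tendsto_binomial`), the Vandermonde determinant is homogeneous, and the interlacing weights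
are all equal to `1 + lam` once the particles are separated. So `σ ^ (m (m + 1) / 2)` times the
probability of an array converges to the density of the GUE-corners process
(`tendsto_cylinderWeight`).

*Weak convergence.* The continuous analogue of the summation above shows that the densities for
`m + 1` and `m` levels are consistent, so that they all have total mass one
(`lintegral_gueCornersDensity`). Since no mass is lost in the limit, lower bounds suffice: spreading
the atoms over lattice cells and applying Fatou's lemma bounds the limit measure of an open set by
the lower limit of its probabilities (`gueCorners_le_liminf`), and the portmanteau theorem applies.
-/

/-! ### Dominos as edges of a bipartite graph -/

namespace AztecDiamond

/-- The domino covering the particle cell `gridCell n ℓ k`, in the direction given by two flags: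
`q = (ℓ, k, s, t)`, where `s` says that the cell carries a particle and `t` that the domino goes
down, i.e. that its other cell is `dualCell n j (k - 1)` rather than `dualCell n j k`; here
`j = ℓ` if `s` holds and `j = ℓ - 1` otherwise. -/
def edge (n : ℕ) : ℕ × ℕ × Bool × Bool → Domino
  | (ℓ, k, true, false) => hDomino (gridCell n ℓ k)
  | (ℓ, k, true, true) => vDomino ((gridCell n ℓ k).1, (gridCell n ℓ k).2 - 1)
  | (ℓ, k, false, true) => hDomino ((gridCell n ℓ k).1 - 1, (gridCell n ℓ k).2)
  | (ℓ, k, false, false) => vDomino (gridCell n ℓ k)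

/-- The cell of the other colour whose centre lies on the dual line `x - y = 2 j - n`, between the
levels `j` and `j + 1`, and on `x + y = 2 p + 1 - n`. -/
def dualCell (n : ℕ) (j p : ℤ) : Cell := (j + p - n, p - j)

theorem edge_injective (n : ℕ) : Function.Injective (edge n) := by
  rintro ⟨ℓ, k, s, t⟩ ⟨ℓ', k', s', t'⟩ h
  cases s <;> cases t <;> cases s' <;> cases t' <;>
    simp only [edge, gridCell, Prod.mk.injEq, Bool.true_eq_false, Bool.false_eq_true,
      and_true, and_false] at h ⊢ <;> omega

/-- The edge `(ℓ, k, s, t)` has both its cells in the Aztec diamond of order `n`. -/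
def IsEdge (n : ℕ) (q : ℕ × ℕ × Bool × Bool) : Prop :=
  1 ≤ q.1 ∧ q.1 ≤ n ∧ q.2.1 ≤ n ∧ (q.2.2.2 = true → 1 ≤ q.2.1) ∧ (q.2.2.2 = false → q.2.1 < n)

theorem mem_dominos {n : ℕ} {d : Domino} : d ∈ dominos n ↔ d.cells ⊆ region n := by
  obtain ⟨⟨a, b⟩, v⟩ := d
  simp only [dominos, Finset.mem_filter, Finset.mem_product, Finset.mem_univ, and_true,
    and_iff_right_iff_imp]
  intro h
  exact h (by cases v <;> simp [Domino.cells])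

theorem edge_mem_dominos {n : ℕ} {q : ℕ × ℕ × Bool × Bool} :
    edge n q ∈ dominos n ↔ IsEdge n q := by
  obtain ⟨ℓ, k, s, t⟩ := q
  rw [mem_dominos]
  cases s <;> cases t <;>
    simp only [edge, Domino.cells, Finset.insert_subset_iff, Finset.singleton_subset_iff,
      gridCell, IsEdge, if_true, if_false, Bool.false_eq_true, Bool.true_eq_false, mem_region] <;>
    simp only [forall_const, IsEmpty.forall_iff, true_and, and_true] <;> omega

theorem exists_edge {n : ℕ} {d : Domino} (hd : d ∈ dominos n) : ∃ q, IsEdge n q ∧ edge n q = d := by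
  suffices h : ∃ q, edge n q = d by
    obtain ⟨q, rfl⟩ := h
    exact ⟨q, edge_mem_dominos.1 hd, rfl⟩
  obtain ⟨⟨a, b⟩, v⟩ := d
  rw [mem_dominos] at hd
  rcases Int.even_or_odd' (a + b + 1 + n) with ⟨c, hc | hc⟩ <;> cases v <;>
    simp only [Domino.cells, Finset.insert_subset_iff, Finset.singleton_subset_iff,
      if_true, if_false, Bool.false_eq_true, mem_region] at hd
  · refine ⟨((c - b).toNat, c.toNat, true, false), ?_⟩
    simp only [edge, gridCell, Prod.mk.injEq, and_true]
    omega
  · refine ⟨((c - b).toNat, c.toNat, false, false), ?_⟩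
    simp only [edge, gridCell, Prod.mk.injEq, and_true]
    omega
  · refine ⟨((c + 1 - b).toNat, (c + 1).toNat, false, true), ?_⟩
    simp only [edge, gridCell, Prod.mk.injEq, and_true]
    omega
  · refine ⟨((c - b).toNat, (c + 1).toNat, true, true), ?_⟩
    simp only [edge, gridCell, Prod.mk.injEq, and_true]
    omega

open Classical in
/-- The indicator that the edge `(ℓ, k, s, t)` belongs to `T`. -/
noncomputable def ind (n : ℕ) (T : Finset Domino) (ℓ k : ℕ) (s t : Bool) : ℕ :=
  if edge n (ℓ, k, s, t) ∈ T then 1 else 0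

theorem card_filter_mem_cells (T : Finset Domino) (a b : ℤ) :
    (T.filter fun d => (a, b) ∈ Domino.cells d).card =
      (if hDomino (a, b) ∈ T then 1 else 0) + (if hDomino (a - 1, b) ∈ T then 1 else 0) +
      (if vDomino (a, b) ∈ T then 1 else 0) + (if vDomino (a, b - 1) ∈ T then 1 else 0) := by
  have h : (T.filter fun d => (a, b) ∈ Domino.cells d) =
      ({hDomino (a, b), hDomino (a - 1, b), vDomino (a, b), vDomino (a, b - 1)} :
        Finset Domino).filter (· ∈ T) := by
    ext ⟨⟨x, y⟩, v⟩
    simp only [Finset.mem_filter, Finset.mem_insert, Finset.mem_singleton]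
    rw [and_comm]
    refine and_congr_left fun _ => ?_
    cases v <;> simp [Domino.cells, Prod.ext_iff] <;> omega
  rw [h, Finset.card_filter, Finset.sum_insert (by simp; omega), Finset.sum_insert (by simp),
    Finset.sum_insert (by simp [Prod.ext_iff]; omega), Finset.sum_singleton]
  simp only [add_assoc]

theorem card_filter_gridCell (n : ℕ) (T : Finset Domino) (ℓ k : ℕ) :
    (T.filter fun d => gridCell n ℓ k ∈ Domino.cells d).card =
      ind n T ℓ k true false + ind n T ℓ k true true + ind n T ℓ k false false +
        ind n T ℓ k false true := by
  obtain ⟨⟨a, b⟩, hc⟩ : ∃ c, gridCell n ℓ k = c := ⟨_, rfl⟩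
  have e1 : edge n (ℓ, k, true, false) = hDomino (a, b) := by simp [edge, hc]
  have e2 : edge n (ℓ, k, true, true) = vDomino (a, b - 1) := by simp [edge, hc]
  have e3 : edge n (ℓ, k, false, false) = vDomino (a, b) := by simp [edge, hc]
  have e4 : edge n (ℓ, k, false, true) = hDomino (a - 1, b) := by simp [edge, hc]
  rw [hc, card_filter_mem_cells, ind, ind, ind, ind]
  simp only [e1, e2, e3, e4]
  ring

theorem card_filter_dualCell (n : ℕ) (T : Finset Domino) (j p : ℕ) :
    (T.filter fun d => dualCell n j p ∈ Domino.cells d).card =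
      ind n T j p true false + ind n T j (p + 1) true true + ind n T (j + 1) p false false +
        ind n T (j + 1) (p + 1) false true := by
  have e1 : edge n (j, p, true, false) = hDomino ((j : ℤ) + p - n - 1, (p : ℤ) - j) := by
    simp only [edge, gridCell, Prod.mk.injEq, and_true]; omega
  have e2 : edge n (j, p + 1, true, true) = vDomino ((j : ℤ) + p - n, (p : ℤ) - j) := by
    simp only [edge, gridCell, Prod.mk.injEq, and_true]; omega
  have e3 : edge n (j + 1, p, false, false) = vDomino ((j : ℤ) + p - n, (p : ℤ) - j - 1) := by
    simp only [edge, gridCell, Prod.mk.injEq, and_true]; omega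
  have e4 : edge n (j + 1, p + 1, false, true) = hDomino ((j : ℤ) + p - n, (p : ℤ) - j) := by
    simp only [edge, gridCell, Prod.mk.injEq, and_true]; omega
  rw [dualCell, card_filter_mem_cells, ind, ind, ind, ind]
  simp only [e1, e2, e3, e4]
  ring

/-- The two colour classes of cells. -/
theorem gridCell_or_dualCell {n : ℕ} {c : Cell} (hc : c ∈ region n) :
    (∃ ℓ k : ℕ, 1 ≤ ℓ ∧ ℓ ≤ n ∧ k ≤ n ∧ c = gridCell n ℓ k) ∨
      ∃ j p : ℕ, j ≤ n ∧ p < n ∧ c = dualCell n j p := by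
  obtain ⟨a, b⟩ := c
  rw [mem_region] at hc
  rcases Int.even_or_odd' (a + b + 1 + n) with ⟨c, h | h⟩
  · refine Or.inl ⟨(c - b).toNat, c.toNat, ?_, ?_, ?_, ?_⟩
    all_goals first | omega | (simp only [gridCell, Prod.mk.injEq]; omega)
  · refine Or.inr ⟨(c - b).toNat, c.toNat, ?_, ?_, ?_⟩
    all_goals first | omega | (simp only [dualCell, Prod.mk.injEq]; omega)

theorem gridCell_mem_region {n ℓ k : ℕ} (h1 : 1 ≤ ℓ) (h2 : ℓ ≤ n) (h3 : k ≤ n) :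
    gridCell n ℓ k ∈ region n := by
  rw [gridCell, mem_region]
  omega

theorem dualCell_mem_region {n j p : ℕ} (h2 : j ≤ n) (h3 : p < n) :
    dualCell n j p ∈ region n := by
  rw [dualCell, mem_region]
  omega

/-- Tilings as perfect matchings of the two colour classes of cells. -/
theorem mem_tilings_iff {n : ℕ} {T : Finset Domino} :
    T ∈ tilings n ↔ T ⊆ dominos n ∧
      (∀ ℓ k, 1 ≤ ℓ → ℓ ≤ n → k ≤ n → ind n T ℓ k true false + ind n T ℓ k true true +
        ind n T ℓ k false false + ind n T ℓ k false true = 1) ∧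
      ∀ j p, j ≤ n → p < n → ind n T j p true false + ind n T j (p + 1) true true +
        ind n T (j + 1) p false false + ind n T (j + 1) (p + 1) false true = 1 := by
  rw [tilings, Finset.mem_filter, Finset.mem_powerset]
  refine and_congr_right fun _ => ⟨fun h => ⟨fun ℓ k h1 h2 h3 => ?_, fun j p h1 h2 => ?_⟩,
    fun h c hc => ?_⟩
  · rw [← card_filter_gridCell, h _ (gridCell_mem_region h1 h2 h3)]
  · rw [← card_filter_dualCell, h _ (dualCell_mem_region h1 h2)]
  · rcases gridCell_or_dualCell hc with ⟨ℓ, k, h1, h2, h3, rfl⟩ | ⟨j, p, h1, h2, rfl⟩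
    · rw [card_filter_gridCell, h.1 ℓ k h1 h2 h3]
    · rw [card_filter_dualCell, h.2 j p h1 h2]

theorem ind_eq_zero {n : ℕ} {T : Finset Domino} (hT : T ⊆ dominos n) {ℓ k : ℕ} {s t : Bool}
    (h : ¬ IsEdge n (ℓ, k, s, t)) : ind n T ℓ k s t = 0 :=
  if_neg fun h' => h (edge_mem_dominos.1 (hT h'))

theorem ind_eq_one {n : ℕ} {T : Finset Domino} {ℓ k : ℕ} {s t : Bool} :
    ind n T ℓ k s t = 1 ↔ edge n (ℓ, k, s, t) ∈ T := by
  simp [ind]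

theorem ind_ne_zero {n : ℕ} {T : Finset Domino} {ℓ k : ℕ} {s t : Bool} :
    ind n T ℓ k s t ≠ 0 ↔ edge n (ℓ, k, s, t) ∈ T := by
  simp [ind]

theorem ind_le_one {n : ℕ} {T : Finset Domino} {ℓ k : ℕ} {s t : Bool} : ind n T ℓ k s t ≤ 1 := by
  rw [ind]; split_ifs <;> simp

theorem hasParticle_iff {n : ℕ} {T : Finset Domino} {ℓ k : ℕ} (hT : T ⊆ dominos n) :
    HasParticle n T ℓ k ↔ ind n T ℓ k true false + ind n T ℓ k true true ≠ 0 := by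
  have h : (hDomino (gridCell n ℓ k) ∈ T ∨
      vDomino ((gridCell n ℓ k).1, (gridCell n ℓ k).2 - 1) ∈ T) ↔
      ind n T ℓ k true false + ind n T ℓ k true true ≠ 0 := by
    rw [ne_eq, Nat.add_eq_zero_iff, not_and_or, ← ne_eq, ← ne_eq, ind_ne_zero, ind_ne_zero]
    rfl
  rw [HasParticle, h, and_iff_right_iff_imp]
  intro h
  by_contra hk
  refine h ?_
  rw [ind_eq_zero hT (fun h => hk h.2.2.1), ind_eq_zero hT (fun h => hk h.2.2.1)]

/-! ### Counting particles and vertical dominos -/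

open Classical in
/-- The number of `i < k` with `p i`. -/
noncomputable def cnt (p : ℕ → Prop) (k : ℕ) : ℕ := Nat.count p k

theorem cnt_zero (p : ℕ → Prop) : cnt p 0 = 0 := by simp [cnt]

open Classical in
theorem cnt_succ (p : ℕ → Prop) (k : ℕ) : cnt p (k + 1) = cnt p k + if p k then 1 else 0 := by
  simp [cnt, Nat.count_succ]

theorem cnt_of_forall_not {p : ℕ → Prop} (h : ∀ k, ¬ p k) (k : ℕ) : cnt p k = 0 := by
  induction k with
  | zero => exact cnt_zero p
  | succ k ih => rw [cnt_succ, ih, if_neg (h k)]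

theorem cnt_of_forall_lt {p : ℕ → Prop} {k : ℕ} (h : ∀ i < k, p i) : cnt p k = k := by
  induction k with
  | zero => exact cnt_zero p
  | succ k ih => rw [cnt_succ, ih fun i hi => h i (by omega), if_pos (h k (by omega))]

/-- The particle sets `X 1, …, X n` of the levels of an Aztec diamond of order `n`, complemented by
the empty level `0` and the full level `n + 1`. -/
structure IsLevels (n : ℕ) (X : ℕ → ℕ → Prop) : Prop where
  zero : ∀ k, ¬ X 0 k
  full : ∀ k, X (n + 1) k ↔ k ≤ n

/-- Compatibility at height `k` of consecutive levels with particle sets `p` and `q`; the flag `a`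
says that there is a particle of `p` at height `k` whose domino goes down. The number of dominos
going down from the cells at height `k` of the two levels to their common dual line is
`cnt q k - cnt p k`; it is `0` or `1`, as both would cover the same dual cell. No domino goes up
from height `n`, which is the last condition. -/
def LocalOK (n : ℕ) (p q : ℕ → Prop) (k : ℕ) (a : Prop) : Prop :=
  cnt p k ≤ cnt q k ∧ cnt q k ≤ cnt p k + 1 ∧
  cnt p (k + 1) ≤ cnt q (k + 1) ∧ cnt q (k + 1) ≤ cnt p (k + 1) + 1 ∧
  (a → cnt q k = cnt p k + 1 ∧ p k) ∧ (¬ a → cnt q k = cnt p k + 1 → ¬ q k) ∧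
  (k = n → cnt q (n + 1) = cnt p (n + 1) + 1)

/-- `X` describes the particles of `T`. -/
def Describes (n : ℕ) (X : ℕ → ℕ → Prop) (T : Finset Domino) : Prop :=
  ∀ j, 1 ≤ j → j ≤ n → ∀ k, HasParticle n T j k ↔ X j k

section fiber

variable {n : ℕ} {X : ℕ → ℕ → Prop} {T : Finset Domino}

open Classical in
theorem ind_particle (hX : IsLevels n X) (hT : T ∈ tilings n) (h : Describes n X T) {j k : ℕ}
    (hj : j ≤ n) (hk : k ≤ n) :
    ind n T j k true false + ind n T j k true true = if X j k then 1 else 0 := by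
  obtain ⟨hsub, hA, hB⟩ := mem_tilings_iff.1 hT
  rcases Nat.eq_zero_or_pos j with rfl | hj0
  · rw [if_neg (hX.zero k), ind_eq_zero hsub (fun h => by simpa using h.1),
      ind_eq_zero hsub (fun h => by simpa using h.1)]
  · have h1 := hA j k hj0 hj hk
    have h2 := hasParticle_iff (ℓ := j) (k := k) hsub
    rw [h j hj0 hj] at h2
    split_ifs with hx
    · have := h2.1 hx; omega
    · have := not_not.1 (mt h2.2 hx); omega

open Classical in
theorem ind_hole (hX : IsLevels n X) (hT : T ∈ tilings n) (h : Describes n X T) {j k : ℕ}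
    (hj : j ≤ n) (hk : k ≤ n) :
    ind n T (j + 1) k false false + ind n T (j + 1) k false true =
      if X (j + 1) k then 0 else 1 := by
  obtain ⟨hsub, hA, hB⟩ := mem_tilings_iff.1 hT
  rcases Nat.eq_or_lt_of_le hj with rfl | hj0
  · rw [if_pos ((hX.full k).2 hk), ind_eq_zero hsub (fun h => by simpa using h.2.1),
      ind_eq_zero hsub (fun h => by simpa using h.2.1)]
  · have h1 := hA (j + 1) k (by omega) hj0 hk
    have h2 := ind_particle hX hT h (j := j + 1) (k := k) hj0 hk
    split_ifs at h2 ⊢ with hx <;> omega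

/-- The number of particles of a level below `k` determines the number of dominos that go down from
height `k`, by counting the cells of a dual line. -/
theorem cnt_succ_level (hX : IsLevels n X) (hT : T ∈ tilings n) (h : Describes n X T) {j k : ℕ}
    (hj : j ≤ n) (hk : k ≤ n) :
    cnt (X (j + 1)) k = cnt (X j) k + ind n T j k true true + ind n T (j + 1) k false true := by
  obtain ⟨hsub, hA, hB⟩ := mem_tilings_iff.1 hT
  induction k with
  | zero =>
    rw [ind_eq_zero hsub (fun h => by simpa using h.2.2.2.1 rfl),
      ind_eq_zero hsub (fun h => by simpa using h.2.2.2.1 rfl), cnt_zero, cnt_zero]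
  | succ k ih =>
    have ih := ih (by omega)
    have h1 := ind_particle hX hT h hj (k := k) (by omega)
    have h2 := ind_hole hX hT h hj (k := k) (by omega)
    have h3 := hB j k hj (by omega)
    rw [cnt_succ, cnt_succ]
    split_ifs at * <;> omega

theorem cnt_succ_level_top (hX : IsLevels n X) (hT : T ∈ tilings n) (h : Describes n X T) {j : ℕ}
    (hj : j ≤ n) : cnt (X (j + 1)) (n + 1) = cnt (X j) (n + 1) + 1 := by
  obtain ⟨hsub, hA, hB⟩ := mem_tilings_iff.1 hT
  have h0 := cnt_succ_level hX hT h hj le_rfl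
  have h1 := ind_particle hX hT h hj (k := n) le_rfl
  have h2 := ind_hole hX hT h hj (k := n) le_rfl
  have h3 := ind_eq_zero hsub (ℓ := j) (k := n) (s := true) (t := false)
    (fun h => by simpa using h.2.2.2.2 rfl)
  have h4 := ind_eq_zero hsub (ℓ := j + 1) (k := n) (s := false) (t := false)
    (fun h => by simpa using h.2.2.2.2 rfl)
  rw [cnt_succ, cnt_succ]
  split_ifs at * <;> omega

theorem cnt_level (hX : IsLevels n X) (hT : T ∈ tilings n) (h : Describes n X T) {j : ℕ}
    (hj : j ≤ n + 1) : cnt (X j) (n + 1) = j := by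
  induction j with
  | zero => exact cnt_of_forall_not hX.zero _
  | succ j ih => rw [cnt_succ_level_top hX hT h (by omega), ih (by omega)]

/-- Half of the vertical dominos carry a particle in their upper cell. -/
theorem sum_ind_eq (hX : IsLevels n X) (hT : T ∈ tilings n) (h : Describes n X T) :
    ∑ j ∈ Finset.range (n + 1), ∑ k ∈ Finset.range (n + 1), ind n T j k true true =
      ∑ j ∈ Finset.range (n + 1), ∑ k ∈ Finset.range (n + 1), ind n T (j + 1) k false false := by
  -- Both sums complement the number of holes that go down to `∑ k ≤ n, k`.
  have h1 : ∑ j ∈ Finset.range (n + 1), ∑ k ∈ Finset.range (n + 1),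
      (ind n T j k true true + ind n T (j + 1) k false true) = ∑ k ∈ Finset.range (n + 1), k := by
    rw [Finset.sum_comm]
    refine Finset.sum_congr rfl fun k hk => ?_
    rw [Finset.mem_range] at hk
    have key : ∀ m, m ≤ n + 1 → ∑ j ∈ Finset.range m,
        (ind n T j k true true + ind n T (j + 1) k false true) = cnt (X m) k := by
      intro m hm
      induction m with
      | zero => rw [Finset.sum_range_zero, cnt_of_forall_not hX.zero]
      | succ m ih =>
        rw [Finset.sum_range_succ, ih (by omega),
          cnt_succ_level hX hT h (by omega) (by omega : k ≤ n)]
        ring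
    rw [key _ le_rfl]
    exact cnt_of_forall_lt fun i hi => (hX.full i).2 (by omega)
  have h2 : ∑ j ∈ Finset.range (n + 1), ∑ k ∈ Finset.range (n + 1),
      (ind n T (j + 1) k false false + ind n T (j + 1) k false true) =
        ∑ k ∈ Finset.range (n + 1), k := by
    rw [← Finset.sum_range_reflect]
    refine Finset.sum_congr rfl fun j hj => ?_
    rw [Finset.mem_range] at hj
    obtain ⟨i, hi, hj'⟩ : ∃ i, i ≤ n ∧ i = n + 1 - 1 - j := ⟨_, by omega, rfl⟩
    rw [← hj']
    have key : ∀ m, m ≤ n + 1 → ∑ k ∈ Finset.range m,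
        (ind n T (i + 1) k false false + ind n T (i + 1) k false true) + cnt (X (i + 1)) m =
          m := by
      intro m hm
      induction m with
      | zero => rw [Finset.sum_range_zero, cnt_zero]
      | succ m ih =>
        have := ih (by omega)
        rw [Finset.sum_range_succ, ind_hole hX hT h (by omega) (by omega), cnt_succ]
        split_ifs <;> omega
    have := key _ le_rfl
    rw [cnt_level hX hT h (by omega)] at this
    omega
  simp only [Finset.sum_add_distrib] at h1 h2
  omega

theorem numVertical_eq (hT : T ∈ tilings n) :
    numVertical T =
      ∑ j ∈ Finset.range (n + 1), ∑ k ∈ Finset.range (n + 1), ind n T j k true true +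
      ∑ j ∈ Finset.range (n + 1), ∑ k ∈ Finset.range (n + 1), ind n T (j + 1) k false false := by
  obtain ⟨hsub, hA, hB⟩ := mem_tilings_iff.1 hT
  let Q : Finset (ℕ × ℕ × Bool × Bool) :=
    Finset.Icc 1 n ×ˢ Finset.range (n + 1) ×ˢ Finset.univ ×ˢ Finset.univ
  have hTQ : T.filter (fun d => d.2 = true) =
      (Q.filter fun q => edge n q ∈ T ∧ (edge n q).2 = true).image (edge n) := by
    ext d
    simp only [Finset.mem_filter, Finset.mem_image]
    constructor
    · rintro ⟨hd, hv⟩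
      obtain ⟨q, hq, rfl⟩ := exists_edge (hsub hd)
      refine ⟨q, ⟨?_, hd, hv⟩, rfl⟩
      obtain ⟨h1, h2, h3, -⟩ := hq
      simp only [Q, Finset.mem_product, Finset.mem_Icc, Finset.mem_range, Finset.mem_univ, and_true]
      omega
    · rintro ⟨q, ⟨-, h1, h2⟩, rfl⟩
      exact ⟨h1, h2⟩
  have e1 : ∀ j k, (edge n (j, k, true, true)).2 = true := fun _ _ => rfl
  have e2 : ∀ j k, (edge n (j, k, true, false)).2 = false := fun _ _ => rfl
  have e3 : ∀ j k, (edge n (j, k, false, true)).2 = false := fun _ _ => rfl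
  have e4 : ∀ j k, (edge n (j, k, false, false)).2 = true := fun _ _ => rfl
  rw [numVertical, hTQ, Finset.card_image_of_injective _ (edge_injective n), Finset.card_filter,
    Finset.sum_product]
  simp only [Finset.sum_product, Fintype.sum_bool, e1, e2, e3, e4, and_true, and_false,
    Bool.false_eq_true, if_false, add_zero, zero_add]
  have hIcc : ∀ f : ℕ → ℕ, ∑ j ∈ Finset.Icc 1 n, f j = ∑ j ∈ Finset.range n, f (j + 1) := by
    intro f
    rw [show Finset.Icc 1 n = Finset.Ico 1 (n + 1) by ext; simp]
    simpa [add_comm] using Finset.sum_Ico_eq_sum_range f 1 (n + 1)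
  rw [Finset.sum_range_succ', Finset.sum_range_succ (fun j => ∑ k ∈ Finset.range (n + 1),
    ind n T (j + 1) k false false), hIcc, Finset.sum_eq_zero (s := Finset.range (n + 1))
    (f := fun k => ind n T 0 k true true), Finset.sum_eq_zero (s := Finset.range (n + 1))
    (f := fun k => ind n T (n + 1) k false false), add_zero, add_zero, ← Finset.sum_add_distrib]
  · refine Finset.sum_congr rfl fun j _ => ?_
    rw [← Finset.sum_add_distrib]
    rfl
  · exact fun k _ => ind_eq_zero hsub fun h => by simpa using h.2.1
  · exact fun k _ => ind_eq_zero hsub fun h => by simpa using h.1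

end fiber

/-! ### Tilings with given particle sets -/

/-- The grid of all heights on the dual lines `0, …, n`. -/
def grid (n : ℕ) : Finset (ℕ × ℕ) := Finset.range (n + 1) ×ˢ Finset.range (n + 1)

open Classical in
/-- The tiling with particle sets `X` in which the particles that go down are those of `E`.
A hole goes down if exactly one domino goes down at its height to the dual line below its level and
that domino does not belong to a particle. -/
noncomputable def tilingOf (n : ℕ) (X : ℕ → ℕ → Prop) (E : Finset (ℕ × ℕ)) : Finset Domino :=
  ((Finset.Icc 1 n ×ˢ Finset.range (n + 1) ×ˢ Finset.univ ×ˢ Finset.univ).filter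
    fun q : ℕ × ℕ × Bool × Bool =>
      if q.2.2.1 = true then X q.1 q.2.1 ∧ (q.2.2.2 = true ↔ (q.1, q.2.1) ∈ E)
      else ¬ X q.1 q.2.1 ∧ (q.2.2.2 = true ↔
        (cnt (X q.1) q.2.1 = cnt (X (q.1 - 1)) q.2.1 + 1 ∧ (q.1 - 1, q.2.1) ∉ E))).image (edge n)

open Classical in
/-- The particles of `T` whose domino goes down. -/
noncomputable def downSet (n : ℕ) (T : Finset Domino) : Finset (ℕ × ℕ) :=
  (grid n).filter fun q => edge n (q.1, q.2, true, true) ∈ T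

/-- `E` is compatible with the particle sets `X` at all heights of all dual lines. -/
def Compatible (n : ℕ) (X : ℕ → ℕ → Prop) (E : Finset (ℕ × ℕ)) : Prop :=
  ∀ q ∈ grid n, LocalOK n (X q.1) (X (q.1 + 1)) q.2 (q ∈ E)

theorem mem_grid {n j k : ℕ} : (j, k) ∈ grid n ↔ j ≤ n ∧ k ≤ n := by
  simp [grid]

section

variable {n : ℕ} {X : ℕ → ℕ → Prop} {T : Finset Domino} {E : Finset (ℕ × ℕ)}

theorem edge_mem_tilingOf {ℓ k : ℕ} {s t : Bool} :
    edge n (ℓ, k, s, t) ∈ tilingOf n X E ↔ (1 ≤ ℓ ∧ ℓ ≤ n ∧ k ≤ n) ∧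
      if s = true then X ℓ k ∧ (t = true ↔ (ℓ, k) ∈ E)
      else ¬ X ℓ k ∧ (t = true ↔
        (cnt (X ℓ) k = cnt (X (ℓ - 1)) k + 1 ∧ (ℓ - 1, k) ∉ E)) := by
  classical
  rw [tilingOf, (edge_injective n).mem_finset_image, Finset.mem_filter]
  simp only [Finset.mem_product, Finset.mem_Icc, Finset.mem_range, Finset.mem_univ, and_true,
    Nat.lt_succ_iff, and_assoc]

open Classical in
theorem ind_tilingOf_particle (hX : IsLevels n X) {j k : ℕ} (hj : j ≤ n) (hk : k ≤ n) (t : Bool) :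
    ind n (tilingOf n X E) j k true t = if X j k ∧ (t = true ↔ (j, k) ∈ E) then 1 else 0 := by
  rw [ind]
  refine if_congr ?_ rfl rfl
  rw [edge_mem_tilingOf, if_pos rfl, and_iff_right_iff_imp]
  rintro ⟨hx, -⟩
  rcases Nat.eq_zero_or_pos j with rfl | h
  · exact absurd hx (hX.zero k)
  · exact ⟨h, hj, hk⟩

open Classical in
theorem ind_tilingOf_hole (hX : IsLevels n X) {j k : ℕ} (hj : j ≤ n) (hk : k ≤ n) (t : Bool) :
    ind n (tilingOf n X E) (j + 1) k false t = if ¬ X (j + 1) k ∧ (t = true ↔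
      (cnt (X (j + 1)) k = cnt (X j) k + 1 ∧ (j, k) ∉ E)) then 1 else 0 := by
  rw [ind]
  refine if_congr ?_ rfl rfl
  rw [edge_mem_tilingOf, if_neg Bool.false_ne_true, Nat.add_sub_cancel, and_iff_right_iff_imp]
  rintro ⟨hx, -⟩
  rcases Nat.eq_or_lt_of_le hj with rfl | h
  · exact absurd ((hX.full k).2 hk) hx
  · exact ⟨by omega, h, hk⟩

theorem tilingOf_subset (hX : IsLevels n X) (hE : Compatible n X E) :
    tilingOf n X E ⊆ dominos n := by
  classical
  intro d hd
  obtain ⟨⟨ℓ, k, s, t⟩, -, rfl⟩ := Finset.mem_image.1 hd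
  rw [edge_mem_tilingOf] at hd
  obtain ⟨⟨h1, h2, h3⟩, h⟩ := hd
  rw [edge_mem_dominos]
  refine ⟨h1, h2, h3, fun ht => ?_, fun ht => ?_⟩ <;> simp only at ht h3 ⊢ <;> subst ht
  · by_contra hk
    obtain rfl : k = 0 := by omega
    cases s
    · rw [if_neg Bool.false_ne_true] at h
      have := (h.2.1 rfl).1
      simp [cnt_zero] at this
    · rw [if_pos rfl] at h
      have := (hE (ℓ, 0) (mem_grid.2 ⟨h2, h3⟩)).2.2.2.2.1 (h.2.1 rfl)
      simp [cnt_zero] at this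
  · by_contra hk
    obtain rfl : k = n := by omega
    cases s
    · rw [if_neg Bool.false_ne_true] at h
      obtain ⟨ℓ, rfl⟩ : ∃ i, ℓ = i + 1 := ⟨ℓ - 1, by omega⟩
      obtain ⟨a1, a2, a3, a4, a5, a6, a7⟩ := hE (ℓ, k) (mem_grid.2 ⟨by omega, h3⟩)
      simp only [Nat.add_sub_cancel] at h
      have h8 := a7 rfl
      simp only [cnt_succ, if_neg h.1] at h8 a4 a3 a1 a2
      by_cases hm : (ℓ, k) ∈ E
      · have := a5 hm
        rw [if_pos this.2] at h8
        simp only at this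
        omega
      · have : ¬ cnt (X (ℓ + 1)) k = cnt (X ℓ) k + 1 := fun hc => by simp [hc, hm] at h
        split_ifs at h8 <;> omega
    · rw [if_pos rfl] at h
      obtain ⟨a1, a2, a3, a4, a5, a6, a7⟩ := hE (ℓ, k) (mem_grid.2 ⟨by omega, h3⟩)
      have h8 := a7 rfl
      have hm : (ℓ, k) ∉ E := fun hc => by simp [hc] at h
      simp only [cnt_succ, if_pos h.1] at h8 a1 a2
      have := a6 hm
      simp only at this
      split_ifs at h8 with hy
      · exact this (by omega) hy
      · omega

/-- The compatibility conditions are sufficient. -/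
theorem tilingOf_mem (hX : IsLevels n X) (hE : Compatible n X E) : tilingOf n X E ∈ tilings n := by
  classical
  rw [mem_tilings_iff]
  refine ⟨tilingOf_subset hX hE, fun ℓ k h1 h2 h3 => ?_, fun j k h1 h2 => ?_⟩
  · obtain ⟨ℓ, rfl⟩ : ∃ i, ℓ = i + 1 := ⟨ℓ - 1, by omega⟩
    rw [ind_tilingOf_particle hX h2 h3, ind_tilingOf_particle hX h2 h3,
      ind_tilingOf_hole hX (by omega) h3, ind_tilingOf_hole hX (by omega) h3]
    simp only [Bool.false_eq_true, false_iff, true_iff]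
    by_cases hx : X (ℓ + 1) k
    · simp only [hx, true_and, not_true, false_and, if_false, add_zero]
      by_cases he : (ℓ + 1, k) ∈ E <;> simp [he]
    · simp only [hx, true_and, not_false_iff, false_and, if_false, zero_add]
      by_cases he : cnt (X (ℓ + 1)) k = cnt (X ℓ) k + 1 ∧ (ℓ, k) ∉ E <;> simp only [he] <;> simp
  · rw [ind_tilingOf_particle hX h1 (by omega), ind_tilingOf_particle hX h1 (by omega),
      ind_tilingOf_hole hX (by omega) (by omega), ind_tilingOf_hole hX (by omega) (by omega)]
    simp only [Bool.false_eq_true, false_iff, true_iff]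
    obtain ⟨a1, a2, a3, a4, a5, a6, -⟩ := hE (j, k) (mem_grid.2 ⟨h1, by omega⟩)
    obtain ⟨b1, b2, b3, b4, b5, b6, -⟩ := hE (j, k + 1) (mem_grid.2 ⟨h1, by omega⟩)
    simp only at *
    have e1 := cnt_succ (X j) k
    have e2 := cnt_succ (X (j + 1)) k
    have f1 := cnt_succ (X j) (k + 1)
    have f2 := cnt_succ (X (j + 1)) (k + 1)
    grind

theorem describes_tilingOf (hX : IsLevels n X) (hn : ∀ j k, j ≤ n → X j k → k ≤ n)
    (hE : Compatible n X E) : Describes n X (tilingOf n X E) := by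
  classical
  intro j h1 h2 k
  by_cases hk : k ≤ n
  · rw [hasParticle_iff (tilingOf_subset hX hE), ind_tilingOf_particle hX h2 hk,
      ind_tilingOf_particle hX h2 hk]
    by_cases hx : X j k
    · by_cases he : (j, k) ∈ E <;> simp [hx, he]
    · simp [hx]
  · exact iff_of_false (fun h => hk h.1) fun h => hk (hn j k h2 h)

/-- The compatibility conditions are necessary. -/
theorem compatible_downSet (hX : IsLevels n X) (hT : T ∈ tilings n) (h : Describes n X T) :
    Compatible n X (downSet n T) := by
  classical
  rintro ⟨j, k⟩ hq
  obtain ⟨hj, hk⟩ := mem_grid.1 hq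
  have e : (j, k) ∈ downSet n T ↔ ind n T j k true true = 1 := by
    rw [ind_eq_one, downSet, Finset.mem_filter, and_iff_right hq]
  have h1 := cnt_succ_level hX hT h hj hk
  have h2 := ind_particle hX hT h hj hk
  have h3 := ind_hole hX hT h hj hk
  have hle : ∀ i, i ≤ n → ind n T j i true true + ind n T (j + 1) i false true ≤ 1 := by
    intro i hi
    rcases i with _ | i
    · rw [ind_eq_zero (mem_tilings_iff.1 hT).1 fun h => by simpa using h.2.2.2.1 rfl,
        ind_eq_zero (mem_tilings_iff.1 hT).1 fun h => by simpa using h.2.2.2.1 rfl]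
      simp
    · have := (mem_tilings_iff.1 hT).2.2 j i hj hi
      omega
  have h4 : cnt (X j) (k + 1) ≤ cnt (X (j + 1)) (k + 1) ∧
      cnt (X (j + 1)) (k + 1) ≤ cnt (X j) (k + 1) + 1 := by
    rcases Nat.eq_or_lt_of_le hk with rfl | hk'
    · rw [cnt_succ_level_top hX hT h hj]
      omega
    · have := cnt_succ_level hX hT h hj (k := k + 1) hk'
      have := hle (k + 1) hk'
      omega
  have h5 := hle k hk
  unfold LocalOK
  simp only [e]
  refine ⟨by omega, by omega, h4.1, h4.2, fun ha => ⟨by omega, ?_⟩, fun ha hc hx => ?_, fun hkn => ?_⟩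
  · by_contra hx
    rw [if_neg hx] at h2
    omega
  · rw [if_pos hx] at h3
    omega
  · exact cnt_succ_level_top hX hT h hj

theorem tilingOf_downSet (hX : IsLevels n X) (hT : T ∈ tilings n) (h : Describes n X T) :
    tilingOf n X (downSet n T) = T := by
  classical
  have hC := compatible_downSet hX hT h
  have hsub := (mem_tilings_iff.1 hT).1
  ext d
  suffices H : ∀ q, IsEdge n q → (edge n q ∈ tilingOf n X (downSet n T) ↔ edge n q ∈ T) by
    constructor
    · intro hd
      obtain ⟨q, hq, rfl⟩ := exists_edge (tilingOf_subset hX hC hd)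
      exact (H q hq).1 hd
    · intro hd
      obtain ⟨q, hq, rfl⟩ := exists_edge (hsub hd)
      exact (H q hq).2 hd
  rintro ⟨ℓ, k, s, t⟩ ⟨h1, h2, h3, -⟩
  simp only at h1 h2 h3
  obtain ⟨j, rfl⟩ : ∃ i, ℓ = i + 1 := ⟨ℓ - 1, by omega⟩
  have e : ∀ i, i ≤ n → ((i, k) ∈ downSet n T ↔ ind n T i k true true = 1) := fun i hi => by
    rw [ind_eq_one, downSet, Finset.mem_filter, and_iff_right (mem_grid.2 ⟨hi, h3⟩)]
  have p1 := ind_particle hX hT h h2 h3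
  have p2 := ind_hole hX hT h (j := j) (by omega) h3
  have p3 := cnt_succ_level hX hT h (j := j) (by omega) h3
  have p4 := ind_le_one (n := n) (T := T) (ℓ := j) (k := k) (s := true) (t := true)
  have p5 : cnt (X (j + 1)) k ≤ cnt (X j) k + 1 := (hC (j, k) (mem_grid.2 ⟨by omega, h3⟩)).2.1
  clear hsub hC hT h
  rw [← ind_eq_one, ← ind_eq_one]
  cases s
  · rw [ind_tilingOf_hole hX (by omega) h3]
    cases t <;> simp only [e j (by omega), Bool.false_eq_true, false_iff, true_iff] <;> grind
  · rw [ind_tilingOf_particle hX (by omega) h3]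
    cases t <;> simp only [e _ h2, Bool.false_eq_true, false_iff, true_iff] <;> grind

theorem downSet_tilingOf (hX : IsLevels n X) (hE : Compatible n X E) (hEn : E ⊆ grid n) :
    downSet n (tilingOf n X E) = E := by
  classical
  ext ⟨j, k⟩
  rw [downSet, Finset.mem_filter]
  simp only
  constructor
  · rintro ⟨h1, h2⟩
    rw [edge_mem_tilingOf, if_pos rfl] at h2
    exact h2.2.2.1 rfl
  · intro he
    have hg := mem_grid.1 (hEn he)
    refine ⟨hEn he, ?_⟩
    rw [← ind_eq_one, ind_tilingOf_particle hX hg.1 hg.2]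
    have := (hE _ (hEn he)).2.2.2.2.1 he
    simp [he, this.2]

open Classical in
/-- The local weight of two consecutive levels at height `k`, summed over the two possible
directions of the domino of a particle there; at a height without particle only the second term can
be present. -/
noncomputable def localWeight (lam : ℝ) (n : ℕ) (p q : ℕ → Prop) (k : ℕ) : ℝ :=
  (if LocalOK n p q k True then lam else 0) + if LocalOK n p q k False then 1 else 0

theorem weight_eq_pow {lam : ℝ} (hlam : 0 < lam) (hX : IsLevels n X) (hT : T ∈ tilings n)
    (h : Describes n X T) : weight lam T = lam ^ (downSet n T).card := by
  classical
  rw [weight, numVertical_eq hT, ← sum_ind_eq hX hT h, ← two_mul, pow_mul,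
    Real.sq_sqrt hlam.le, downSet, Finset.card_filter, grid, Finset.sum_product]
  rfl

open Classical in
/-- The total weight of the tilings with given particle sets is a product of local weights. -/
theorem sum_weight_describes {lam : ℝ} (hlam : 0 < lam) (hX : IsLevels n X)
    (hn : ∀ j k, j ≤ n → X j k → k ≤ n) :
    ∑ T ∈ tilings n with Describes n X T, weight lam T =
      ∏ j ∈ Finset.range (n + 1), ∏ k ∈ Finset.range (n + 1),
        localWeight lam n (X j) (X (j + 1)) k := by
  rw [← Finset.prod_product' (f := fun j k => localWeight lam n (X j) (X (j + 1)) k)]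
  simp only [localWeight]
  rw [Finset.prod_add]
  have hterm : ∀ E ∈ (grid n).powerset,
      (∏ q ∈ E, (if LocalOK n (X q.1) (X (q.1 + 1)) q.2 True then lam else 0)) *
        ∏ q ∈ grid n \ E, (if LocalOK n (X q.1) (X (q.1 + 1)) q.2 False then (1 : ℝ) else 0) =
      if Compatible n X E then lam ^ E.card else 0 := by
    intro E hE
    rw [Finset.mem_powerset] at hE
    split_ifs with hC
    · rw [Finset.prod_congr rfl fun q hq => if_pos _, Finset.prod_congr rfl fun q hq => if_pos _,
        Finset.prod_const, Finset.prod_const_one, mul_one]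
      · intro q hq
        have := hC q (Finset.mem_sdiff.1 hq).1
        rwa [eq_false (Finset.mem_sdiff.1 hq).2] at this
      · intro q hq
        have := hC q (hE hq)
        rwa [eq_true hq] at this
    · rw [Compatible] at hC
      push Not at hC
      obtain ⟨q, hq, hC⟩ := hC
      by_cases hqE : q ∈ E
      · rw [eq_true hqE] at hC
        rw [Finset.prod_eq_zero hqE (if_neg hC), zero_mul]
      · rw [eq_false hqE] at hC
        rw [Finset.prod_eq_zero (Finset.mem_sdiff.2 ⟨hq, hqE⟩) (if_neg hC), mul_zero]
  rw [show Finset.range (n + 1) ×ˢ Finset.range (n + 1) = grid n from rfl,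
    Finset.sum_congr rfl hterm, ← Finset.sum_filter]
  refine Finset.sum_nbij' (downSet n) (tilingOf n X) ?_ ?_ ?_ ?_ ?_
  · intro T hT
    rw [Finset.mem_filter] at hT ⊢
    exact ⟨Finset.mem_powerset.2 (Finset.filter_subset _ _), compatible_downSet hX hT.1 hT.2⟩
  · intro E hE
    rw [Finset.mem_filter] at hE ⊢
    exact ⟨tilingOf_mem hX hE.2, describes_tilingOf hX hn hE.2⟩
  · intro T hT
    rw [Finset.mem_filter] at hT
    exact tilingOf_downSet hX hT.1 hT.2
  · intro E hE
    rw [Finset.mem_filter, Finset.mem_powerset] at hE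
    exact downSet_tilingOf hX hE.2 hE.1
  · intro T hT
    rw [Finset.mem_filter] at hT
    exact weight_eq_pow hlam hX hT.1 hT.2

end

/-! ### Interlacing weights -/

/-- The set of the heights `x 0, …, x (j - 1)`. -/
def levelSet (j : ℕ) (x : ℕ → ℕ) (k : ℕ) : Prop := ∃ i < j, x i = k

/-- The entries `x 0, …, x (j - 1)` are strictly increasing. -/
def StrictIncr (j : ℕ) (x : ℕ → ℕ) : Prop := ∀ i i', i < i' → i' < j → x i < x i'

theorem StrictIncr.le_iff {j : ℕ} {x : ℕ → ℕ} (hx : StrictIncr j x) {i i' : ℕ} (hi : i < j)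
    (hi' : i' < j) : x i ≤ x i' ↔ i ≤ i' := by
  constructor
  · intro h
    by_contra hlt
    have := hx i' i (by omega) hi
    omega
  · intro h
    rcases Nat.eq_or_lt_of_le h with rfl | h
    · exact le_rfl
    · exact (hx i i' h hi').le

theorem StrictIncr.eq_iff {j : ℕ} {x : ℕ → ℕ} (hx : StrictIncr j x) {i i' : ℕ} (hi : i < j)
    (hi' : i' < j) : x i = x i' ↔ i = i' := by
  have h1 := hx.le_iff hi hi'
  have h2 := hx.le_iff hi' hi
  omega

/-- The counting function of a level and the particles of the level are inverse to each other. -/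
theorem cnt_levelSet {j : ℕ} {x : ℕ → ℕ} (hx : StrictIncr j x) (k : ℕ) :
    cnt (levelSet j x) k ≤ j ∧ ∀ i < j, i < cnt (levelSet j x) k ↔ x i < k := by
  classical
  induction k with
  | zero => simp [cnt_zero]
  | succ k ih =>
    rw [cnt_succ]
    by_cases h : levelSet j x k
    · rw [if_pos h]
      obtain ⟨i₀, h₀, rfl⟩ := h
      have hc : cnt (levelSet j x) (x i₀) = i₀ := by
        refine le_antisymm (not_lt.1 fun hlt => ?_) (not_lt.1 fun hlt => ?_)
        · exact lt_irrefl _ ((ih.2 i₀ h₀).1 hlt)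
        · exact lt_irrefl _ ((ih.2 _ (hlt.trans h₀)).2 (hx _ _ hlt h₀))
      rw [hc]
      refine ⟨h₀, fun i hi => ?_⟩
      rw [Nat.lt_succ_iff, Nat.lt_succ_iff, hx.le_iff hi h₀]
    · rw [if_neg h]
      refine ⟨ih.1, fun i hi => ?_⟩
      have : x i ≠ k := fun h' => h ⟨i, hi, h'⟩
      rw [add_zero, ih.2 i hi]
      omega

theorem cnt_levelSet_apply {j : ℕ} {x : ℕ → ℕ} (hx : StrictIncr j x) {i : ℕ} (hi : i < j) :
    cnt (levelSet j x) (x i) = i := by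
  obtain ⟨-, h⟩ := cnt_levelSet hx (x i)
  refine le_antisymm (not_lt.1 fun hlt => ?_) (not_lt.1 fun hlt => ?_)
  · exact lt_irrefl _ ((h i hi).1 hlt)
  · exact lt_irrefl _ ((h _ (hlt.trans hi)).2 (hx _ _ hlt hi))

theorem cnt_levelSet_top {n j : ℕ} {x : ℕ → ℕ} (hx : StrictIncr j x) (hn : ∀ i < j, x i ≤ n) :
    cnt (levelSet j x) (n + 1) = j := by
  obtain ⟨h1, h2⟩ := cnt_levelSet hx (n + 1)
  refine le_antisymm h1 (not_lt.1 fun hlt => ?_)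
  have := (h2 _ hlt).2 (Nat.lt_succ_of_le (hn _ hlt))
  omega

/-- The weight of a particle at `x` between the neighbouring particles `a` and `b` of the next
level: strictly between them its domino can go up or down, at `a` only up and at `b` only down. -/
noncomputable def interlaceWeight (lam : ℝ) (x a b : ℕ) : ℝ :=
  (if a ≤ x ∧ x < b then 1 else 0) + if a < x ∧ x ≤ b then lam else 0

/-- For two levels given by their particles, the product of the local weights over all heights
becomes a product over the particles of the smaller level. -/
theorem prod_localWeight (lam : ℝ) {n j : ℕ} {x y : ℕ → ℕ} (hx : StrictIncr j x)
    (hy : StrictIncr (j + 1) y) (hxn : ∀ i < j, x i ≤ n) (hyn : ∀ i < j + 1, y i ≤ n) :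
    ∏ k ∈ Finset.range (n + 1), localWeight lam n (levelSet j x) (levelSet (j + 1) y) k =
      ∏ i ∈ Finset.range j, interlaceWeight lam (x i) (y i) (y (i + 1)) := by
  classical
  have cx := fun k => cnt_levelSet hx k
  have cy := fun k => cnt_levelSet hy k
  by_cases hint : ∀ i < j, y i ≤ x i ∧ x i ≤ y (i + 1)
  · have hcnt : ∀ k, cnt (levelSet j x) k ≤ cnt (levelSet (j + 1) y) k ∧
        cnt (levelSet (j + 1) y) k ≤ cnt (levelSet j x) k + 1 := by
      intro k
      constructor
      · by_contra hlt
        push Not at hlt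
        have hj : cnt (levelSet (j + 1) y) k < j := lt_of_lt_of_le hlt (cx k).1
        have h1 := ((cx k).2 _ hj).1 hlt
        have h2 := mt ((cy k).2 _ (by omega)).2 (lt_irrefl (cnt (levelSet (j + 1) y) k))
        have := (hint _ hj).1
        omega
      · by_contra hlt
        push Not at hlt
        have hj : cnt (levelSet j x) k < j := by have := (cy k).1; omega
        have h1 := ((cy k).2 _ (by omega)).1 hlt
        have h2 := mt ((cx k).2 _ hj).2 (lt_irrefl _)
        have := (hint _ hj).2
        omega
    have htop : cnt (levelSet (j + 1) y) (n + 1) = cnt (levelSet j x) (n + 1) + 1 := by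
      rw [cnt_levelSet_top hx hxn, cnt_levelSet_top hy hyn]
    have hok : ∀ k a, LocalOK n (levelSet j x) (levelSet (j + 1) y) k a ↔
        (a → cnt (levelSet (j + 1) y) k = cnt (levelSet j x) k + 1 ∧ levelSet j x k) ∧
        (¬ a → cnt (levelSet (j + 1) y) k = cnt (levelSet j x) k + 1 →
          ¬ levelSet (j + 1) y k) := fun k a =>
      ⟨fun h => ⟨h.2.2.2.2.1, h.2.2.2.2.2.1⟩, fun h => ⟨(hcnt k).1, (hcnt k).2, (hcnt _).1,
        (hcnt _).2, h.1, h.2, fun _ => htop⟩⟩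
    -- Only the heights of particles of the lower level contribute a factor different from one.
    have hout : ∀ k, ¬ levelSet j x k →
        localWeight lam n (levelSet j x) (levelSet (j + 1) y) k = 1 := by
      intro k hk
      rw [localWeight, if_neg, if_pos, zero_add]
      · rw [hok]
        refine ⟨False.elim, fun _ h1 h2 => ?_⟩
        have := (hcnt (k + 1)).2
        rw [cnt_succ, cnt_succ, if_pos h2, if_neg hk] at this
        omega
      · rw [hok]
        exact fun h => hk (h.1 trivial).2
    have hin : ∀ i < j, localWeight lam n (levelSet j x) (levelSet (j + 1) y) (x i) =
        interlaceWeight lam (x i) (y i) (y (i + 1)) := by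
      intro i hi
      rw [localWeight, interlaceWeight, add_comm]
      have hi' := hint i hi
      have hx' : levelSet j x (x i) := ⟨i, hi, rfl⟩
      have hci := cnt_levelSet_apply hx hi
      have hc := hcnt (x i)
      have h1 := (cy (x i)).2 i (by omega)
      have hyi : y i < y (i + 1) := hy _ _ (by omega) (by omega)
      congr 1
      · refine if_congr ?_ rfl rfl
        rw [hok]
        simp only [false_imp_iff, true_and, not_false_iff, true_imp_iff]
        constructor
        · intro h
          refine ⟨hi'.1, lt_of_le_of_ne hi'.2 fun he => ?_⟩
          exact h (by omega) ⟨i + 1, by omega, he.symm⟩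
        · rintro ⟨-, h3⟩ h4 ⟨i₁, h5, h6⟩
          have h7 := (hy.le_iff (i := i + 1) (by omega) h5)
          have h8 := (hy.le_iff (i := i₁) h5 (i' := i) (by omega))
          omega
      · refine if_congr ?_ rfl rfl
        rw [hok]
        simp only [not_true, false_imp_iff, and_true, true_imp_iff, hx']
        omega
    rw [← Finset.prod_subset (s₁ := (Finset.range j).image x)]
    · rw [Finset.prod_image]
      · exact Finset.prod_congr rfl fun i hi => hin i (Finset.mem_range.1 hi)
      · intro i hi i' hi' h
        exact (hx.eq_iff (by simpa using hi) (by simpa using hi')).1 h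
    · intro k hk
      obtain ⟨i, hi, rfl⟩ := Finset.mem_image.1 hk
      exact Finset.mem_range.2 (Nat.lt_succ_of_le (hxn i (Finset.mem_range.1 hi)))
    · intro k _ hk
      refine hout k fun ⟨i, hi, h⟩ => hk ?_
      exact Finset.mem_image.2 ⟨i, Finset.mem_range.2 hi, h⟩
  · -- Both sides vanish if the levels do not interlace.
    push Not at hint
    obtain ⟨i, hi, h⟩ := hint
    have hci := cnt_levelSet_apply hx hi
    have hci' : cnt (levelSet j x) (x i + 1) = i + 1 := by
      rw [cnt_succ, hci, if_pos ⟨i, hi, rfl⟩]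
    have hnot : ∀ a, ¬ LocalOK n (levelSet j x) (levelSet (j + 1) y) (x i) a := by
      rintro a ⟨-, h1, h2, -⟩
      rw [hci] at h1
      rw [hci'] at h2
      have h3 := ((cy (x i + 1)).2 i (by omega)).1 (by omega)
      have h4 := mt ((cy (x i)).2 (i + 1) (by omega)).2 (by omega)
      have := h (by omega)
      omega
    rw [Finset.prod_eq_zero (Finset.mem_range.2 (Nat.lt_succ_of_le (hxn i hi))),
      Finset.prod_eq_zero (Finset.mem_range.2 hi)]
    · rw [interlaceWeight, if_neg, if_neg, add_zero]
      · intro h'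
        exact absurd (h h'.1.le) (by omega)
      · intro h'
        exact absurd (h h'.1) (by omega)
    · rw [localWeight, if_neg (hnot _), if_neg (hnot _), add_zero]

/-! ### Tilings with given particles -/

theorem nth_mem_of_lt_cnt {p : ℕ → Prop} {N i : ℕ} (hi : i < cnt p N) : p (Nat.nth p i) := by
  classical
  refine Nat.nth_mem i fun hf => lt_of_lt_of_le hi ?_
  rw [cnt, Nat.count_eq_card_filter_range]
  refine Finset.card_le_card fun k hk => ?_
  simpa using (Finset.mem_filter.1 hk).2

theorem nth_lt_nth_of_lt_cnt {p : ℕ → Prop} {N i i' : ℕ} (hi : i < i') (hi' : i' < cnt p N) :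
    Nat.nth p i < Nat.nth p i' := by
  classical
  refine Nat.nth_lt_nth' hi fun hf => lt_of_lt_of_le hi' ?_
  rw [cnt, Nat.count_eq_card_filter_range]
  refine Finset.card_le_card fun k hk => ?_
  simpa using (Finset.mem_filter.1 hk).2

theorem nth_cnt {p : ℕ → Prop} {k : ℕ} (hk : p k) : Nat.nth p (cnt p k) = k := by
  classical
  exact Nat.nth_count hk

theorem cnt_mono (p : ℕ → Prop) {k k' : ℕ} (h : k ≤ k') : cnt p k ≤ cnt p k' := by
  classical
  exact Nat.count_monotone p h

theorem cnt_lt_of_mem {p : ℕ → Prop} {k N : ℕ} (hk : p k) (hN : k < N) : cnt p k < cnt p N := by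
  classical
  have := cnt_mono p (Nat.succ_le_of_lt hN)
  rw [Nat.succ_eq_add_one, cnt_succ, if_pos hk] at this
  omega

/-- Level `j` carries `j` particles. -/
theorem cnt_hasParticle {n : ℕ} {T : Finset Domino} (hT : T ∈ tilings n) {j : ℕ} (hj : j ≤ n) :
    cnt (HasParticle n T j) (n + 1) = j := by
  have hsub := (mem_tilings_iff.1 hT).1
  let X : ℕ → ℕ → Prop := fun j k => if j = n + 1 then k ≤ n else HasParticle n T j k
  have hXj : ∀ i ≤ n, X i = HasParticle n T i := fun i hi => by
    funext k
    exact if_neg (by omega)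
  have hX : IsLevels n X := by
    refine ⟨fun k => ?_, fun k => by simp [X]⟩
    rw [hXj 0 (Nat.zero_le n), hasParticle_iff hsub, ind_eq_zero hsub fun h => by simpa using h.1,
      ind_eq_zero hsub fun h => by simpa using h.1]
    simp
  have h := cnt_level hX hT (fun i _ hi k => by rw [hXj i hi]) (j := j) (by omega)
  rwa [hXj j hj] at h

/-- The particles of `T` on the levels up to `m` are those of the array `x`, where `x j` lists the
`j` particles of level `j`. -/
def Agrees (n m : ℕ) (x : ℕ → ℕ → ℕ) (T : Finset Domino) : Prop :=
  ∀ j ≤ m, ∀ i < j, particle n T j i = x j i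

theorem Agrees.strictIncr {n m j : ℕ} {x : ℕ → ℕ → ℕ} {T : Finset Domino} (hT : T ∈ tilings n)
    (h : Agrees n m x T) (hm : j ≤ m) (hj : j ≤ n) : StrictIncr j (x j) := by
  intro i i' hi hi'
  rw [← h j hm i (by omega), ← h j hm i' hi']
  exact nth_lt_nth_of_lt_cnt (N := n + 1) hi (by rwa [cnt_hasParticle hT hj])

theorem particle_le {n j i : ℕ} {T : Finset Domino} (hT : T ∈ tilings n) (hj : j ≤ n)
    (hi : i < j) : particle n T j i ≤ n :=
  (nth_mem_of_lt_cnt (N := n + 1) (p := HasParticle n T j) (by rwa [cnt_hasParticle hT hj])).1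

theorem agrees_iff_describes {n : ℕ} {x : ℕ → ℕ → ℕ} {T : Finset Domino} (hT : T ∈ tilings n)
    (hx : ∀ j ≤ n, StrictIncr j (x j)) :
    Agrees n n x T ↔ Describes n (fun j => levelSet j (x j)) T := by
  constructor
  · intro h j _ hj k
    constructor
    · intro hk
      have hlt := cnt_lt_of_mem hk (Nat.lt_succ_of_le hk.1)
      rw [cnt_hasParticle hT hj] at hlt
      exact ⟨_, hlt, by rw [← h j hj _ hlt, particle, nth_cnt hk]⟩
    · rintro ⟨i, hi, rfl⟩
      rw [← h j hj i hi]
      exact nth_mem_of_lt_cnt (N := n + 1) (by rwa [cnt_hasParticle hT hj])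
  · intro h j hj i hi
    have : HasParticle n T j = levelSet j (x j) := funext fun k => propext (h j (by omega) hj k)
    rw [particle, this]
    have h' := nth_cnt (p := levelSet j (x j)) (k := x j i) ⟨i, hi, rfl⟩
    rwa [cnt_levelSet_apply (hx j hj) hi] at h'

theorem interlaceWeight_ne_zero {lam : ℝ} {x a b : ℕ} (h : interlaceWeight lam x a b ≠ 0) :
    a < b ∧ a ≤ x ∧ x ≤ b := by
  rw [interlaceWeight] at h
  split_ifs at h with h1 h2 h2
  · omega
  · omega
  · omega
  · simp at h

theorem strictIncr_of_interlaceWeight_ne_zero {lam : ℝ} {j : ℕ} {x y : ℕ → ℕ}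
    (h : ∏ i ∈ Finset.range j, interlaceWeight lam (x i) (y i) (y (i + 1)) ≠ 0) :
    StrictIncr (j + 1) y := by
  rw [Finset.prod_ne_zero_iff] at h
  have hs : ∀ i < j, y i < y (i + 1) := fun i hi =>
    (interlaceWeight_ne_zero (h i (Finset.mem_range.2 hi))).1
  intro i i' hi hi'
  induction i' with
  | zero => omega
  | succ k ih =>
    rcases Nat.eq_or_lt_of_le (Nat.lt_succ_iff.1 hi) with rfl | hlt
    · exact hs _ (by omega)
    · exact (ih hlt (by omega)).trans (hs k (by omega))

open Classical in
/-- The weight of all tilings with prescribed particles on all levels. The full level `n + 1` closes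
the interlacing pattern. -/
theorem sum_weight_agrees {lam : ℝ} (hlam : 0 < lam) {n : ℕ} {x : ℕ → ℕ → ℕ}
    (htop : ∀ i, x (n + 1) i = i) :
    ∑ T ∈ tilings n with Agrees n n x T, weight lam T =
      ∏ j ∈ Finset.range (n + 1), ∏ i ∈ Finset.range j,
        interlaceWeight lam (x j i) (x (j + 1) i) (x (j + 1) (i + 1)) := by
  by_cases hx : ∀ j ≤ n, StrictIncr j (x j) ∧ ∀ i < j, x j i ≤ n
  · have hx' : ∀ j ≤ n + 1, StrictIncr j (x j) ∧ ∀ i < j, x j i ≤ n := by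
      intro j hj
      rcases Nat.eq_or_lt_of_le hj with rfl | hj
      · refine ⟨fun i i' h _ => by rwa [htop, htop], fun i hi => by rw [htop]; omega⟩
      · exact hx j (by omega)
    have hX : IsLevels n fun j => levelSet j (x j) := by
      refine ⟨fun k ⟨i, hi, _⟩ => by omega, fun k => ⟨?_, fun hk => ⟨k, by omega, htop k⟩⟩⟩
      rintro ⟨i, hi, rfl⟩
      rw [htop]
      omega
    have hX' : ∀ j k, j ≤ n → levelSet j (x j) k → k ≤ n := by
      rintro j k hj ⟨i, hi, rfl⟩
      exact (hx j hj).2 i hi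
    rw [Finset.filter_congr fun T hT => agrees_iff_describes hT fun j hj => (hx j hj).1]
    refine (sum_weight_describes hlam hX hX').trans ?_
    refine Finset.prod_congr rfl fun j hj => ?_
    rw [Finset.mem_range] at hj
    exact prod_localWeight lam (hx' j (by omega)).1 (hx' (j + 1) (by omega)).1
      (hx' j (by omega)).2 (hx' (j + 1) (by omega)).2
  · rw [Finset.filter_false_of_mem, Finset.sum_empty]
    · symm
      by_contra hne
      rw [← ne_eq, Finset.prod_ne_zero_iff] at hne
      refine hx fun j hj => ⟨?_, ?_⟩
      · rcases j with _ | j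
        · intro i i' _ h
          omega
        · exact strictIncr_of_interlaceWeight_ne_zero (hne j (Finset.mem_range.2 (by omega)))
      · have key : ∀ d j, j + d = n + 1 → ∀ i < j, x j i ≤ n := by
          intro d
          induction d with
          | zero =>
            rintro j hj i hi
            obtain rfl : j = n + 1 := by omega
            rw [htop]
            omega
          | succ d ih =>
            intro j hj i hi
            have h1 := Finset.prod_ne_zero_iff.1 (hne j (Finset.mem_range.2 (by omega))) i
              (Finset.mem_range.2 hi)
            exact (interlaceWeight_ne_zero h1).2.2.trans (ih (j + 1) (by omega) (i + 1) (by omega))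
        exact key (n + 1 - j) j (by omega)
    · intro T hT h
      refine hx fun j hj => ⟨h.strictIncr hT hj hj, fun i hi => ?_⟩
      rw [← h j hj i hi]
      exact particle_le hT hj hi

end AztecDiamond

/-! ### Determinants, and summing out a level -/

/-- A determinant whose rows are finite sums. -/
theorem Matrix.det_sum_rows {m : ℕ} {κ : Type*} (S : Fin m → Finset κ)
    (ψ : Fin m → κ → Fin m → ℝ) :
    (Matrix.of fun a b => ∑ e ∈ S a, ψ a e b).det =
      ∑ e ∈ Fintype.piFinset S, (Matrix.of fun a b => ψ a (e a) b).det := by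
  have h := (Matrix.detRowAlternating (R := ℝ) (n := Fin m)).toMultilinearMap.map_sum_finset ψ S
  refine Eq.trans ?_ h
  congr 1
  ext a b
  simp

/-- If the rows of `M` are the increments of the rows of `G` and the last row of `G` is
`(c, 0, …, 0)`, then `det M` reduces to a minor of `G`. -/
theorem Matrix.det_increments {m : ℕ} (M G : Matrix (Fin (m + 1)) (Fin (m + 1)) ℝ) (c : ℝ)
    (h0 : ∀ b, M 0 b = G 0 b) (hs : ∀ (i : Fin m) b, M i.succ b = G i.succ b - G i.castSucc b)
    (hc : G (Fin.last m) 0 = c) (hl : ∀ b : Fin m, G (Fin.last m) b.succ = 0) :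
    M.det = (-1) ^ m * c * (Matrix.of fun a b : Fin m => G a.castSucc b.succ).det := by
  have h1 : G.det = M.det := by
    refine Matrix.det_eq_of_forall_row_eq_smul_add_pred (fun _ => 1) (fun b => (h0 b).symm) ?_
    intro i b
    rw [hs]
    ring
  rw [← h1, Matrix.det_succ_row G (Fin.last m), Fin.sum_univ_succ]
  simp only [hl, hc, Fin.succAbove_last, Fin.val_last, Fin.val_zero, add_zero, mul_zero,
    zero_mul, Finset.sum_const_zero]
  rfl

/-- Row-evaluated polynomials of degrees at most `0, 1, …` give a multiple of the Vandermonde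
determinant. -/
theorem Matrix.det_eval_eq {m : ℕ} (v : Fin m → ℝ) (p : Fin m → Polynomial ℝ)
    (hp : ∀ b, (p b).natDegree ≤ b) :
    (Matrix.of fun a b => (p b).eval (v a)).det =
      (∏ b, (p b).coeff b) * (Matrix.vandermonde v).det := by
  rw [Matrix.eval_matrixOfPolynomials_eq_vandermonde_mul_matrixOfPolynomials v p hp,
    Matrix.det_mul, mul_comm]
  congr 1
  rw [Matrix.det_of_isUpperTriangular]
  · rfl
  · intro i j hij
    exact Polynomial.coeff_eq_zero_of_natDegree_lt (lt_of_le_of_lt (hp j) hij)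

namespace AztecDiamond

/-- The `m`-point weight `∏_{i<j} (y_j - y_i) ∏_i lam ^ y_i * choose n y_i`. -/
noncomputable def krawtchoukWeight (lam : ℝ) (n : ℕ) {m : ℕ} (y : Fin m → ℕ) : ℝ :=
  (Matrix.vandermonde fun i => (y i : ℝ)).det * ∏ i, (lam ^ y i * (n.choose (y i) : ℝ))

/-- The functions `lam ^ w * w * choose n w * w ^ b`. They vanish at `w = 0` and `w = n + 1`, and up
to a constant they are the discrete antiderivatives in `sum_sumPoly_succ`. -/
noncomputable def discAntideriv (lam : ℝ) (n b w : ℕ) : ℝ :=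
  lam ^ w * (w * (n.choose w : ℝ)) * (w : ℝ) ^ b

open Polynomial in
/-- Monic polynomials `p` of all degrees for which `lam ^ y * choose n y * p y` has an explicit sum:
those of positive degree are multiples of the difference of `discAntideriv`, divided by
`lam ^ y * choose n y`. -/
noncomputable def sumPoly (lam : ℝ) (n : ℕ) : ℕ → ℝ[X]
  | 0 => 1
  | b + 1 => C (-(1 + lam)⁻¹) * (C lam * (C (n : ℝ) - X) * (X + 1) ^ b - X ^ (b + 1))

open Polynomial in
/-- The polynomial `(n - X) (X + 1) ^ b + X ^ (b + 1)` of degree at most `b`, written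
so that the cancellation of the leading terms is visible. -/
noncomputable def stepPoly (n b : ℕ) : ℝ[X] :=
  C (n : ℝ) * (X + 1) ^ b - ∑ k ∈ Finset.range b, C (b.choose k : ℝ) * X ^ (k + 1)

open Polynomial in
theorem natDegree_X_add_one_pow_le (b : ℕ) : ((X + 1 : ℝ[X]) ^ b).natDegree ≤ b := by
  have h : (X + 1 : ℝ[X]).natDegree ≤ 1 := by
    rw [← C_1, natDegree_X_add_C]
  simpa using natDegree_pow_le_of_le b h

open Polynomial in
theorem natDegree_sumPoly_le (lam : ℝ) (n b : ℕ) : (sumPoly lam n b).natDegree ≤ b := by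
  rcases b with _ | b
  · simp [sumPoly]
  · rw [sumPoly]
    refine (natDegree_C_mul_le _ _).trans ((natDegree_sub_le _ _).trans
      (max_le ?_ (natDegree_X_pow_le _)))
    rw [mul_assoc]
    refine (natDegree_C_mul_le _ _).trans (natDegree_mul_le.trans ?_)
    rw [add_comm]
    refine add_le_add (natDegree_X_add_one_pow_le b) ?_
    exact (natDegree_sub_le _ _).trans (max_le (by simp) natDegree_X_le)

open Polynomial in
theorem coeff_sumPoly {lam : ℝ} (hlam : 0 < lam) (n b : ℕ) : (sumPoly lam n b).coeff b = 1 := by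
  rcases b with _ | b
  · simp [sumPoly]
  · have h1 : ((X + 1 : ℝ[X]) ^ b).coeff (b + 1) = 0 := by
      rw [coeff_X_add_one_pow]
      simp
    have h2 : ((X + 1 : ℝ[X]) ^ b).coeff b = 1 := by
      rw [coeff_X_add_one_pow]
      simp
    have h3 : (1 + lam) ≠ 0 := by positivity
    rw [sumPoly, mul_assoc (C lam), sub_mul, coeff_C_mul, coeff_sub, coeff_C_mul, coeff_sub,
      coeff_C_mul, coeff_X_mul, h1, h2, coeff_X_pow_self]
    field_simp
    ring

open Polynomial in
theorem natDegree_stepPoly_le (n b : ℕ) : (stepPoly n b).natDegree ≤ b := by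
  rw [stepPoly]
  refine (natDegree_sub_le _ _).trans
    (max_le ((natDegree_C_mul_le _ _).trans (natDegree_X_add_one_pow_le b)) ?_)
  refine natDegree_sum_le_of_forall_le _ _ fun k hk => ?_
  exact (natDegree_C_mul_X_pow_le _ _).trans (Finset.mem_range.1 hk)

open Polynomial in
theorem coeff_stepPoly (n b : ℕ) : (stepPoly n b).coeff b = n - b := by
  have h2 : ((X + 1 : ℝ[X]) ^ b).coeff b = 1 := by
    rw [coeff_X_add_one_pow]
    simp
  rw [stepPoly, coeff_sub, coeff_C_mul, h2, finsetSum_coeff]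
  simp only [coeff_C_mul_X_pow]
  rcases b with _ | b
  · simp
  · rw [Finset.sum_range_succ, Finset.sum_eq_zero]
    · simp
    · intro k hk
      rw [Finset.mem_range] at hk
      exact if_neg (by omega)

open Polynomial in
theorem eval_stepPoly (n b : ℕ) (x : ℝ) :
    (stepPoly n b).eval x = (n - x) * (x + 1) ^ b + x ^ (b + 1) := by
  have h : ∑ k ∈ Finset.range b, (b.choose k : ℝ) * x ^ (k + 1) = x * ((x + 1) ^ b - x ^ b) := by
    rw [add_pow, Finset.sum_range_succ]
    simp only [one_pow, mul_one, Nat.choose_self, Nat.cast_one, add_sub_cancel_right,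
      Finset.mul_sum]
    refine Finset.sum_congr rfl fun k _ => ?_
    ring
  simp only [stepPoly, eval_sub, eval_mul, eval_C, eval_pow, eval_add, eval_X, eval_one,
    eval_finsetSum]
  rw [h]
  ring

theorem succ_mul_choose_succ (n y : ℕ) :
    ((y : ℝ) + 1) * (n.choose (y + 1) : ℝ) = (n - y) * (n.choose y : ℝ) := by
  rcases le_or_gt y n with h | h
  · have := Nat.choose_succ_right_eq n y
    have h' : ((n.choose (y + 1) * (y + 1) : ℕ) : ℝ) = ((n.choose y * (n - y) : ℕ) : ℝ) := by
      rw [this]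
    push_cast [Nat.cast_sub h] at h'
    linarith
  · rw [Nat.choose_eq_zero_of_lt h, Nat.choose_eq_zero_of_lt (by omega)]
    simp

theorem sum_sumPoly_succ (lam : ℝ) (n b w : ℕ) :
    ∑ y ∈ Finset.range w, lam ^ y * (n.choose y : ℝ) * (sumPoly lam n (b + 1)).eval (y : ℝ) =
      -(1 + lam)⁻¹ * discAntideriv lam n b w := by
  induction w with
  | zero => simp [discAntideriv]
  | succ y ih =>
    rw [Finset.sum_range_succ, ih]
    have h := succ_mul_choose_succ n y
    simp only [sumPoly, discAntideriv, Polynomial.eval_mul, Polynomial.eval_sub,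
      Polynomial.eval_C, Polynomial.eval_pow, Polynomial.eval_add, Polynomial.eval_X,
      Polynomial.eval_one]
    push_cast
    rw [h]
    ring

theorem discAntideriv_step (lam : ℝ) (n b x : ℕ) :
    discAntideriv lam n b (x + 1) + lam * discAntideriv lam n b x =
      lam ^ (x + 1) * (n.choose x : ℝ) * (stepPoly n b).eval (x : ℝ) := by
  have h := succ_mul_choose_succ n x
  rw [eval_stepPoly]
  simp only [discAntideriv]
  push_cast
  rw [h]
  ring

theorem krawtchoukWeight_eq_det {lam : ℝ} (hlam : 0 < lam) (n : ℕ) {m : ℕ} (y : Fin m → ℕ) :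
    krawtchoukWeight lam n y = (Matrix.of fun a b : Fin m =>
      lam ^ y a * (n.choose (y a) : ℝ) * (sumPoly lam n b).eval (y a : ℝ)).det := by
  rw [krawtchoukWeight]
  have h := Matrix.det_eval_eq (fun i => (y i : ℝ)) (fun b : Fin m => sumPoly lam n b)
    fun b => natDegree_sumPoly_le lam n b
  simp only [coeff_sumPoly hlam, Finset.prod_const_one, one_mul] at h
  rw [← h, mul_comm, ← Matrix.det_mul_column]
  rfl

/-- The normalization of `sum_interlaceWeight_mul`. -/
noncomputable def levelConst (lam : ℝ) (n m : ℕ) : ℝ :=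
  (1 + lam) ^ n * ∏ b ∈ Finset.range m, (lam * ((n : ℝ) - b) / (1 + lam))

/-- The sum of the weight `krawtchoukWeight` over a box between consecutive points of `w`. The
antiderivatives vanish at the ends of the range except for the constant polynomial, so the
determinant loses its first column and last row. -/
theorem sum_box_krawtchoukWeight {lam : ℝ} (hlam : 0 < lam) {n m : ℕ} (w : Fin m → ℕ)
    (hw : Monotone w) (hwn : ∀ i, w i ≤ n + 1) :
    ∑ y ∈ Fintype.piFinset fun a : Fin (m + 1) =>
        Finset.Ico (Fin.cons (α := fun _ => ℕ) 0 w a) (Fin.snoc (α := fun _ => ℕ) w (n + 1) a),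
      krawtchoukWeight lam n y =
    (1 + lam) ^ n * ((1 + lam)⁻¹) ^ m *
      (Matrix.of fun a b : Fin m => discAntideriv lam n b (w a)).det := by
  simp only [krawtchoukWeight_eq_det hlam]
  rw [← Matrix.det_sum_rows (fun a : Fin (m + 1) =>
    Finset.Ico (Fin.cons (α := fun _ => ℕ) 0 w a) (Fin.snoc (α := fun _ => ℕ) w (n + 1) a))
    (fun _ e b => lam ^ e * (n.choose e : ℝ) * (sumPoly lam n b).eval (e : ℝ))]
  rw [Matrix.det_increments _ (Matrix.of fun a b : Fin (m + 1) =>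
    ∑ y ∈ Finset.range (Fin.snoc (α := fun _ => ℕ) w (n + 1) a),
      lam ^ y * (n.choose y : ℝ) * (sumPoly lam n b).eval (y : ℝ)) ((1 + lam) ^ n)]
  · simp only [Matrix.of_apply, Fin.snoc_castSucc, Fin.val_succ, sum_sumPoly_succ lam]
    rw [show (Matrix.of fun a b : Fin m => -(1 + lam)⁻¹ * discAntideriv lam n b (w a)) =
      (-(1 + lam)⁻¹) • Matrix.of fun a b : Fin m => discAntideriv lam n b (w a) from rfl,
      Matrix.det_smul, Fintype.card_fin, neg_pow ((1 + lam)⁻¹)]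
    have : ((-1 : ℝ)) ^ m * (-1) ^ m = 1 := by rw [← mul_pow]; simp
    linear_combination (1 + lam) ^ n * (1 + lam)⁻¹ ^ m *
      (Matrix.of fun a b : Fin m => discAntideriv lam n b (w a)).det * this
  · intro b
    simp only [Matrix.of_apply, Fin.cons_zero, Finset.range_eq_Ico]
  · intro i b
    simp only [Matrix.of_apply, Fin.cons_succ, Fin.snoc_castSucc]
    refine Finset.sum_Ico_eq_sub _ ?_
    rcases Fin.eq_castSucc_or_eq_last i.succ with ⟨j, hj⟩ | hj
    · rw [hj, Fin.snoc_castSucc]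
      refine hw ?_
      have := congrArg Fin.val hj
      simp only [Fin.val_succ, Fin.val_castSucc] at this
      exact Fin.le_def.2 (by omega)
    · rw [hj, Fin.snoc_last]
      exact hwn i
  · simp only [Matrix.of_apply, Fin.snoc_last, Fin.val_zero, sumPoly, Polynomial.eval_one, mul_one]
    rw [add_comm 1 lam, add_pow]
    simp
  · intro b
    simp only [Matrix.of_apply, Fin.snoc_last, Fin.val_succ, sum_sumPoly_succ lam]
    simp [discAntideriv]

/-- The two terms of `interlaceWeight` as the conditions `a < w ≤ b` for `w = x` and `w = x + 1`. -/
theorem interlaceWeight_eq_sum (lam : ℝ) (x a b : ℕ) :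
    interlaceWeight lam x a b = ∑ e : Bool, (bif e then lam else 1) *
      if a < x + (bif e then 0 else 1) ∧ x + (bif e then 0 else 1) ≤ b then 1 else 0 := by
  rw [interlaceWeight, Fintype.sum_bool, add_comm]
  congr 1 <;> simp

/-- Summing out the level above `x` reproduces the weight of `x`. Expanding the interlacing weights
turns the sum into sums over boxes; recombining the two terms of each `interlaceWeight` row by row
leaves a determinant of polynomials of degrees `0, …, m - 1`. -/
theorem sum_interlaceWeight_mul {lam : ℝ} (hlam : 0 < lam) {n m : ℕ} (x : Fin m → ℕ)
    (hx : StrictMono x) :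
    ∑ y ∈ Fintype.piFinset fun _ : Fin (m + 1) => Finset.range (n + 1),
      (∏ i : Fin m, interlaceWeight lam (x i) (y i.castSucc) (y i.succ)) *
        krawtchoukWeight lam n y = levelConst lam n m * krawtchoukWeight lam n x := by
  by_cases hxn : ∀ i, x i ≤ n
  swap
  · push Not at hxn
    obtain ⟨i, hi⟩ := hxn
    rw [krawtchoukWeight, Finset.prod_eq_zero (Finset.mem_univ i), mul_zero, mul_zero]
    · refine Finset.sum_eq_zero fun y hy => ?_
      rw [Finset.prod_eq_zero (Finset.mem_univ i), zero_mul]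
      by_contra h
      have h1 := (interlaceWeight_ne_zero h).2.2
      have h2 := Finset.mem_range.1 (Fintype.mem_piFinset.1 hy i.succ)
      omega
    · rw [Nat.choose_eq_zero_of_lt hi, Nat.cast_zero, mul_zero]
  let w : (Fin m → Bool) → Fin m → ℕ := fun e i => x i + (bif e i then 0 else 1)
  have hw : ∀ e, Monotone (w e) := by
    intro e i j hij
    rcases eq_or_lt_of_le hij with rfl | hij
    · exact le_rfl
    · have := hx hij
      simp only [w]
      cases e i <;> cases e j <;> simp <;> omega
  have hwn : ∀ e i, w e i ≤ n + 1 := by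
    intro e i
    have := hxn i
    simp only [w]
    cases e i <;> simp <;> omega
  calc _ = ∑ y ∈ Fintype.piFinset fun _ : Fin (m + 1) => Finset.range (n + 1),
        ∑ e : Fin m → Bool, (∏ i, (bif e i then lam else 1)) *
          ((∏ i, if y i.castSucc < w e i ∧ w e i ≤ y i.succ then 1 else 0) *
            krawtchoukWeight lam n y) := by
        refine Finset.sum_congr rfl fun y _ => ?_
        simp only [interlaceWeight_eq_sum]
        rw [Finset.prod_univ_sum, Fintype.piFinset_univ, Finset.sum_mul]
        refine Finset.sum_congr rfl fun e _ => ?_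
        rw [Finset.prod_mul_distrib, mul_assoc]
    _ = ∑ e : Fin m → Bool, (∏ i, (bif e i then lam else 1)) *
          ((1 + lam) ^ n * ((1 + lam)⁻¹) ^ m *
            (Matrix.of fun a b : Fin m => discAntideriv lam n b (w e a)).det) := by
        rw [Finset.sum_comm]
        refine Finset.sum_congr rfl fun e _ => ?_
        rw [← Finset.mul_sum, ← sum_box_krawtchoukWeight hlam (w e) (hw e) (hwn e)]
        congr 1
        rw [← Finset.sum_subset (s₁ := Fintype.piFinset fun a : Fin (m + 1) =>
          Finset.Ico (Fin.cons (α := fun _ => ℕ) 0 (w e) a)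
            (Fin.snoc (α := fun _ => ℕ) (w e) (n + 1) a))]
        · refine Finset.sum_congr rfl fun y hy => ?_
          rw [Fintype.mem_piFinset] at hy
          rw [Finset.prod_eq_one, one_mul]
          intro i _
          refine if_pos ⟨?_, ?_⟩
          · simpa using (Finset.mem_Ico.1 (hy i.castSucc)).2
          · simpa using (Finset.mem_Ico.1 (hy i.succ)).1
        · refine Fintype.piFinset_subset _ _ fun a k hk => ?_
          rw [Finset.mem_Ico] at hk
          refine Finset.mem_range.2 (hk.2.trans_le ?_)
          rcases Fin.eq_castSucc_or_eq_last a with ⟨j, rfl⟩ | rfl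
          · rw [Fin.snoc_castSucc]
            exact hwn e j
          · rw [Fin.snoc_last]
        · intro y hy hy'
          rw [Fintype.mem_piFinset] at hy hy'
          push Not at hy'
          obtain ⟨a, ha⟩ := hy'
          have hya := Finset.mem_range.1 (hy a)
          rw [Finset.mem_Ico, not_and_or] at ha
          rcases ha with ha | ha
          · rcases Fin.eq_zero_or_eq_succ a with rfl | ⟨i, rfl⟩
            · simp at ha
            · rw [Fin.cons_succ] at ha
              rw [Finset.prod_eq_zero (Finset.mem_univ i) (if_neg fun h => ha h.2), zero_mul]
          · rcases Fin.eq_castSucc_or_eq_last a with ⟨i, rfl⟩ | rfl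
            · rw [Fin.snoc_castSucc] at ha
              rw [Finset.prod_eq_zero (Finset.mem_univ i) (if_neg fun h => ha h.1), zero_mul]
            · rw [Fin.snoc_last] at ha
              exact absurd hya ha
    _ = (1 + lam) ^ n * ((1 + lam)⁻¹) ^ m * ∑ e : Fin m → Bool,
          (Matrix.of fun a b : Fin m => (bif e a then lam else 1) *
            discAntideriv lam n b (x a + (bif e a then 0 else 1))).det := by
        rw [Finset.mul_sum]
        refine Finset.sum_congr rfl fun e _ => ?_
        have h := Matrix.det_mul_column (fun i => (bif e i then lam else 1))
          (Matrix.of fun a b : Fin m => discAntideriv lam n b (w e a))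
        simp only [Matrix.of_apply] at h
        rw [h]
        ring
    _ = (1 + lam) ^ n * ((1 + lam)⁻¹) ^ m * (Matrix.of fun a b : Fin m =>
          lam ^ (x a + 1) * (n.choose (x a) : ℝ) * (stepPoly n b).eval (x a : ℝ)).det := by
        have h := Matrix.det_sum_rows (fun _ : Fin m => (Finset.univ : Finset Bool))
          fun a e b => (bif e then lam else 1) *
            discAntideriv lam n b (x a + (bif e then 0 else 1))
        rw [Fintype.piFinset_univ] at h
        rw [← h]
        congr 3
        ext a b
        rw [Fintype.sum_bool, ← discAntideriv_step]
        simp [add_comm]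
    _ = _ := by
        have h1 := Matrix.det_mul_column (fun i => lam ^ (x i + 1) * (n.choose (x i) : ℝ))
          (Matrix.of fun a b : Fin m => (stepPoly n b).eval (x a : ℝ))
        have h2 := Matrix.det_eval_eq (fun i => (x i : ℝ)) (fun b : Fin m => stepPoly n b)
          fun b => natDegree_stepPoly_le n b
        simp only [Matrix.of_apply] at h1
        rw [h1, h2, levelConst, krawtchoukWeight, ← Fin.prod_univ_eq_prod_range
          (fun b => lam * ((n : ℝ) - b) / (1 + lam))]
        simp only [coeff_stepPoly, pow_succ, div_eq_mul_inv, Finset.prod_mul_distrib,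
          Finset.prod_const, Finset.card_univ, Fintype.card_fin]
        ring

/-! ### The law of the first levels -/

/-- The weight of the array `x` on its levels `1, …, m`, up to a constant the probability that the
particles on these levels are given by `x`. -/
noncomputable def arrayWeight (lam : ℝ) (n m : ℕ) (x : ℕ → ℕ → ℕ) : ℝ :=
  (∏ j ∈ Finset.range m, ∏ i ∈ Finset.range j,
    interlaceWeight lam (x j i) (x (j + 1) i) (x (j + 1) (i + 1))) *
      krawtchoukWeight lam n fun i : Fin m => x m i

/-- Replaces the level `j` of the array `x` by `y`. -/
def setLevel (x : ℕ → ℕ → ℕ) (j : ℕ) (y : Fin j → ℕ) : ℕ → ℕ → ℕ :=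
  Function.update x j fun i => if h : i < j then y ⟨i, h⟩ else 0

theorem setLevel_self (x : ℕ → ℕ → ℕ) (j : ℕ) (y : Fin j → ℕ) {i : ℕ} (hi : i < j) :
    setLevel x j y j i = y ⟨i, hi⟩ := by
  rw [setLevel, Function.update_self, dif_pos hi]

theorem setLevel_of_ne (x : ℕ → ℕ → ℕ) {j j' : ℕ} (y : Fin j → ℕ) (h : j' ≠ j) :
    setLevel x j y j' = x j' := by
  rw [setLevel, Function.update_of_ne h]

theorem strictMono_of_prod_ne_zero {lam : ℝ} {m : ℕ} {x : ℕ → ℕ → ℕ}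
    (h : ∏ j ∈ Finset.range m, ∏ i ∈ Finset.range j,
      interlaceWeight lam (x j i) (x (j + 1) i) (x (j + 1) (i + 1)) ≠ 0) :
    StrictMono fun i : Fin m => x m i := by
  rcases m with _ | m
  · exact fun i => i.elim0
  · have h1 := Finset.prod_ne_zero_iff.1 h m (Finset.self_mem_range_succ m)
    have h2 := strictIncr_of_interlaceWeight_ne_zero h1
    exact fun i i' hi => h2 i i' hi i'.isLt

/-- The array weights are consistent, up to a constant, under summing out the last level. -/
theorem sum_arrayWeight {lam : ℝ} (hlam : 0 < lam) (n m : ℕ) (x : ℕ → ℕ → ℕ) :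
    ∑ y ∈ Fintype.piFinset fun _ : Fin (m + 1) => Finset.range (n + 1),
      arrayWeight lam n (m + 1) (setLevel x (m + 1) y) =
        levelConst lam n m * arrayWeight lam n m x := by
  have key : ∀ y : Fin (m + 1) → ℕ, arrayWeight lam n (m + 1) (setLevel x (m + 1) y) =
      (∏ j ∈ Finset.range m, ∏ i ∈ Finset.range j,
        interlaceWeight lam (x j i) (x (j + 1) i) (x (j + 1) (i + 1))) *
      ((∏ i : Fin m, interlaceWeight lam (x m i) (y i.castSucc) (y i.succ)) *
        krawtchoukWeight lam n y) := by
    intro y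
    rw [arrayWeight, Finset.prod_range_succ, mul_assoc]
    congr 1
    · refine Finset.prod_congr rfl fun j hj => Finset.prod_congr rfl fun i hi => ?_
      rw [Finset.mem_range] at hj
      rw [setLevel_of_ne x y (by omega), setLevel_of_ne x y (by omega)]
    · congr 1
      · rw [← Fin.prod_univ_eq_prod_range (fun i => interlaceWeight lam
          (setLevel x (m + 1) y m i) (setLevel x (m + 1) y (m + 1) i)
          (setLevel x (m + 1) y (m + 1) (i + 1)))]
        refine Finset.prod_congr rfl fun i _ => ?_
        rw [setLevel_of_ne x y (by omega), setLevel_self x _ y (by omega),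
          setLevel_self x _ y (by omega)]
        rfl
      · congr 1
        funext i
        rw [setLevel_self x _ y i.isLt]
  simp only [key]
  rw [← Finset.mul_sum, arrayWeight]
  by_cases h : ∏ j ∈ Finset.range m, ∏ i ∈ Finset.range j,
      interlaceWeight lam (x j i) (x (j + 1) i) (x (j + 1) (i + 1)) = 0
  · rw [h, zero_mul, zero_mul, mul_zero]
  · rw [sum_interlaceWeight_mul hlam _ (strictMono_of_prod_ne_zero h)]
    ring

open Classical in
/-- The total weight of the tilings whose particles on the levels up to `m` are given by `x`. -/
noncomputable def cylinderWeight (lam : ℝ) (n m : ℕ) (x : ℕ → ℕ → ℕ) : ℝ :=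
  ∑ T ∈ tilings n with Agrees n m x T, weight lam T

theorem sum_cylinderWeight (lam : ℝ) {n m : ℕ} (hm : m + 1 ≤ n) (x : ℕ → ℕ → ℕ) :
    ∑ y ∈ Fintype.piFinset fun _ : Fin (m + 1) => Finset.range (n + 1),
      cylinderWeight lam n (m + 1) (setLevel x (m + 1) y) = cylinderWeight lam n m x := by
  classical
  simp only [cylinderWeight]
  rw [← Finset.sum_fiberwise_of_maps_to
    (g := fun T => fun i : Fin (m + 1) => particle n T (m + 1) i)
    (t := Fintype.piFinset fun _ : Fin (m + 1) => Finset.range (n + 1))]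
  · refine Finset.sum_congr rfl fun y _ => ?_
    rw [Finset.filter_filter]
    refine Finset.sum_congr (Finset.filter_congr fun T _ => ?_) fun _ _ => rfl
    constructor
    · intro h
      refine ⟨fun j hj i hi => ?_, funext fun i => ?_⟩
      · rw [h j (by omega) i hi, setLevel_of_ne x y (by omega)]
      · rw [h (m + 1) le_rfl i i.isLt, setLevel_self x _ y i.isLt]
    · rintro ⟨h1, h2⟩ j hj i hi
      rcases Nat.eq_or_lt_of_le hj with rfl | hj
      · rw [setLevel_self x _ y hi, ← h2]
      · rw [setLevel_of_ne x y (by omega), h1 j (by omega) i hi]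
  · intro T hT
    rw [Fintype.mem_piFinset]
    intro i
    exact Finset.mem_range.2 (Nat.lt_succ_of_le
      (particle_le (Finset.mem_filter.1 hT).1 hm i.isLt))

theorem strictMono_fin_eq {n : ℕ} {y : Fin (n + 1) → ℕ} (hy : StrictMono y)
    (hn : ∀ i, y i ≤ n) (i : Fin (n + 1)) : y i = i := by
  let z : Fin (n + 1) → Fin (n + 1) := fun i => ⟨y i, Nat.lt_succ_of_le (hn i)⟩
  have hz : StrictMono z := fun i j h => hy h
  have h := congrFun (Finite.injective_iff_surjective.1 hz.injective |> fun hs =>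
    (StrictMono.range_inj (f := z) (g := id) hz strictMono_id).1
      (by rw [hs.range_eq, Set.range_id])) i
  exact congrArg Fin.val h

/-- The full level `0, …, n` is the only possible level `n + 1`. -/
theorem prod_interlaceWeight_full {lam : ℝ} (hlam : 0 < lam) {n : ℕ} (x : Fin n → ℕ)
    (hx : StrictMono x) :
    (∏ i : Fin n, interlaceWeight lam (x i) i (i + 1)) *
        krawtchoukWeight lam n (fun i : Fin (n + 1) => (i : ℕ)) =
      levelConst lam n n * krawtchoukWeight lam n x := by
  rw [← sum_interlaceWeight_mul hlam x hx,
    Finset.sum_eq_single_of_mem (fun i : Fin (n + 1) => (i : ℕ))]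
  · simp
  · rw [Fintype.mem_piFinset]
    exact fun i => Finset.mem_range.2 i.isLt
  · intro y hy hne
    rw [Fintype.mem_piFinset] at hy
    by_contra h
    obtain ⟨h1, h2⟩ := mul_ne_zero_iff.1 h
    rw [Finset.prod_ne_zero_iff] at h1
    refine hne (funext fun i => strictMono_fin_eq ?_ (fun i => ?_) i)
    · exact Fin.strictMono_iff_lt_succ.2 fun i =>
        (interlaceWeight_ne_zero (h1 i (Finset.mem_univ i))).1
    · exact Nat.lt_succ_iff.1 (Finset.mem_range.1 (hy i))

theorem krawtchoukWeight_full_ne_zero {lam : ℝ} (hlam : 0 < lam) (n : ℕ) :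
    krawtchoukWeight lam n (fun i : Fin (n + 1) => (i : ℕ)) ≠ 0 := by
  rw [krawtchoukWeight]
  refine mul_ne_zero ?_ (Finset.prod_ne_zero_iff.2 fun i _ => ?_)
  · rw [Matrix.det_vandermonde_ne_zero_iff]
    exact fun i j h => Fin.ext (by simpa using h)
  · have := Nat.choose_pos (Nat.lt_succ_iff.1 i.isLt)
    positivity

theorem levelConst_pos {lam : ℝ} (hlam : 0 < lam) {n m : ℕ} (hm : m ≤ n) :
    0 < levelConst lam n m := by
  rw [levelConst]
  refine mul_pos (by positivity) (Finset.prod_pos fun b hb => ?_)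
  have : (b : ℝ) < n := by exact_mod_cast (Finset.mem_range.1 hb).trans_le hm
  have : (0 : ℝ) < n - b := by linarith
  positivity

/-- The law of all levels: the factor from level `n` to the full level `n + 1` has the form of a
`krawtchoukWeight`. -/
theorem cylinderWeight_top {lam : ℝ} (hlam : 0 < lam) (n : ℕ) (x : ℕ → ℕ → ℕ) :
    cylinderWeight lam n n x = levelConst lam n n /
      krawtchoukWeight lam n (fun i : Fin (n + 1) => (i : ℕ)) * arrayWeight lam n n x := by
  classical
  let x' := Function.update x (n + 1) id
  have h := sum_weight_agrees hlam (n := n) (x := x') fun i => by simp [x']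
  have hne : ∀ j, j ≤ n → x' j = x j := fun j hj => Function.update_of_ne (by omega) _ _
  have hA : ∀ T, Agrees n n x' T ↔ Agrees n n x T := fun T =>
    forall_congr' fun j => forall_congr' fun hj => by rw [hne j hj]
  simp only [hA] at h
  rw [cylinderWeight, h, Finset.prod_range_succ, arrayWeight, Finset.prod_congr rfl
    fun j hj => by rw [hne j (Finset.mem_range.1 hj).le, hne (j + 1) (Finset.mem_range.1 hj)]]
  by_cases h0 : ∏ j ∈ Finset.range n, ∏ i ∈ Finset.range j,
      interlaceWeight lam (x j i) (x (j + 1) i) (x (j + 1) (i + 1)) = 0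
  · rw [h0, zero_mul, zero_mul, mul_zero]
  · have h1 := prod_interlaceWeight_full hlam _ (strictMono_of_prod_ne_zero h0)
    have h2 := krawtchoukWeight_full_ne_zero hlam n
    rw [← Fin.prod_univ_eq_prod_range (fun i => interlaceWeight lam (x' n i) (x' (n + 1) i)
      (x' (n + 1) (i + 1)))]
    have h3 : ∀ i, x' (n + 1) i = i := fun i => by simp [x']
    simp only [h3, hne n le_rfl]
    field_simp
    linear_combination h1

/-- The law of the particles on the first `m` levels, by downward induction on `m` from `m = n`. The
proportionality factor is identified with the partition function at `m = 0`. -/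
theorem cylinderWeight_mul {lam : ℝ} (hlam : 0 < lam) {n m : ℕ} (hm : m ≤ n) (x : ℕ → ℕ → ℕ) :
    cylinderWeight lam n m x * ∏ l ∈ Finset.range m, levelConst lam n l =
      partitionFunction lam n * arrayWeight lam n m x := by
  classical
  obtain ⟨κ, hκ⟩ : ∃ κ, ∀ x, cylinderWeight lam n n x = κ * arrayWeight lam n n x :=
    ⟨_, cylinderWeight_top hlam n⟩
  have key : ∀ d m, m + d = n → ∀ x, cylinderWeight lam n m x *
      ∏ l ∈ Finset.range m, levelConst lam n l =
      κ * (∏ l ∈ Finset.range n, levelConst lam n l) * arrayWeight lam n m x := by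
    intro d
    induction d with
    | zero =>
      rintro m rfl x
      rw [add_zero] at hκ ⊢
      rw [hκ]
      ring
    | succ d ih =>
      intro m hm x
      have h1 := fun y => ih (m + 1) (by omega) (setLevel x (m + 1) y)
      have hpos := levelConst_pos hlam (n := n) (m := m) (by omega)
      rw [← sum_cylinderWeight lam (by omega : m + 1 ≤ n) x, Finset.sum_mul]
      refine mul_right_cancel₀ hpos.ne' ?_
      rw [Finset.sum_mul]
      simp only [mul_assoc, ← Finset.prod_range_succ]
      rw [Finset.sum_congr rfl fun y _ => h1 y, ← Finset.mul_sum, sum_arrayWeight hlam]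
      ring
  have h0 := key n 0 (by omega) x
  have hZ : cylinderWeight lam n 0 x = partitionFunction lam n := by
    rw [cylinderWeight, Finset.filter_true_of_mem, partitionFunction]
    intro T _ j hj i hi
    omega
  have hD : arrayWeight lam n 0 x = 1 := by
    simp [arrayWeight, krawtchoukWeight]
  rw [hZ, hD, Finset.prod_range_zero, mul_one, mul_one] at h0
  rw [key (n - m) m (by omega) x, ← h0]

end AztecDiamond

/-! ### Integrating out a level of the Gaussian density -/

theorem integrable_pow_mul_gaussian (b : ℕ) :
    Integrable fun t : ℝ => t ^ b * Real.exp (-(1 / 2) * t ^ 2) := by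
  have h := integrable_rpow_mul_exp_neg_mul_sq (b := 1 / 2) (by norm_num) (s := (b : ℝ))
    (by have : (0 : ℝ) ≤ b := b.cast_nonneg
        linarith)
  simpa only [Real.rpow_natCast] using h

theorem tendsto_pow_mul_gaussian (b : ℕ) :
    Tendsto (fun t : ℝ => t ^ b * Real.exp (-(1 / 2) * t ^ 2)) (cocompact ℝ) (𝓝 0) := by
  have h := tendsto_rpow_abs_mul_exp_neg_mul_sq_cocompact (a := 1 / 2) (by norm_num) (b : ℝ)
  rw [tendsto_zero_iff_norm_tendsto_zero]
  refine h.congr fun t => ?_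
  rw [norm_mul, norm_pow, Real.norm_eq_abs, Real.norm_eq_abs, Real.abs_exp, Real.rpow_natCast]

open Polynomial in
/-- Monic polynomials `p` whose product with the Gaussian weight is a derivative, except for
`p = 1`. -/
noncomputable def gaussPoly : ℕ → ℝ[X]
  | 0 => 1
  | b + 1 => X ^ (b + 1) - C (b : ℝ) * X ^ (b - 1)

open Polynomial in
theorem natDegree_gaussPoly_le (b : ℕ) : (gaussPoly b).natDegree ≤ b := by
  rcases b with _ | b
  · simp [gaussPoly]
  · rw [gaussPoly]
    refine (natDegree_sub_le _ _).trans (max_le (natDegree_X_pow_le _) ?_)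
    exact (natDegree_C_mul_X_pow_le _ _).trans (by omega)

open Polynomial in
theorem coeff_gaussPoly (b : ℕ) : (gaussPoly b).coeff b = 1 := by
  rcases b with _ | b
  · simp [gaussPoly]
  · rw [gaussPoly, coeff_sub, coeff_X_pow_self, coeff_C_mul_X_pow, if_neg (by omega), sub_zero]

/-- The polynomial `gaussPoly b` times the Gaussian weight. -/
noncomputable def gaussFun (b : ℕ) (t : ℝ) : ℝ :=
  (gaussPoly b).eval t * Real.exp (-(1 / 2) * t ^ 2)

theorem integrable_gaussFun (b : ℕ) : Integrable (gaussFun b) := by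
  have h : gaussFun b = fun t => ∑ i ∈ Finset.range ((gaussPoly b).natDegree + 1),
      (gaussPoly b).coeff i * (t ^ i * Real.exp (-(1 / 2) * t ^ 2)) := by
    funext t
    rw [gaussFun, Polynomial.eval_eq_sum_range, Finset.sum_mul]
    exact Finset.sum_congr rfl fun i _ => by ring
  rw [h]
  exact integrable_finsetSum _ fun i _ => (integrable_pow_mul_gaussian i).const_mul _

theorem hasDerivAt_gaussFun_succ (b : ℕ) (t : ℝ) :
    HasDerivAt (fun t => -(t ^ b * Real.exp (-(1 / 2) * t ^ 2))) (gaussFun (b + 1) t) t := by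
  have h1 : HasDerivAt (fun t : ℝ => -(1 / 2) * t ^ 2) (-(1 / 2) * (2 * t)) t := by
    simpa using (hasDerivAt_pow 2 t).const_mul (-(1 / 2) : ℝ)
  refine ((hasDerivAt_pow b t).mul h1.exp).neg.congr_deriv ?_
  simp only [gaussFun, gaussPoly, Polynomial.eval_sub, Polynomial.eval_mul, Polynomial.eval_pow,
    Polynomial.eval_X, Polynomial.eval_C]
  ring

theorem integral_Iic_gaussFun_succ (b : ℕ) (u : ℝ) :
    ∫ t in Set.Iic u, gaussFun (b + 1) t = -(u ^ b * Real.exp (-(1 / 2) * u ^ 2)) := by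
  rw [integral_Iic_of_hasDerivAt_of_tendsto' (fun t _ => hasDerivAt_gaussFun_succ b t)
    (integrable_gaussFun _).integrableOn (m := 0), sub_zero]
  simpa using ((tendsto_pow_mul_gaussian b).mono_left atBot_le_cocompact).neg

theorem integral_gaussFun_succ (b : ℕ) : ∫ t, gaussFun (b + 1) t = 0 := by
  rw [integral_of_hasDerivAt_of_tendsto (fun t => hasDerivAt_gaussFun_succ b t)
    (integrable_gaussFun _) (m := 0) (n := 0), sub_zero]
  · simpa using ((tendsto_pow_mul_gaussian b).mono_left atBot_le_cocompact).neg
  · simpa using ((tendsto_pow_mul_gaussian b).mono_left atTop_le_cocompact).neg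

theorem integral_gaussFun_zero : ∫ t, gaussFun 0 t = Real.sqrt (2 * Real.pi) := by
  have h := integral_gaussian (1 / 2)
  simp only [gaussFun, gaussPoly, Polynomial.eval_one, one_mul]
  rw [h]
  congr 1
  ring

theorem integrable_det {m : ℕ} {ψ : Fin m → Fin m → ℝ → ℝ} (h : ∀ a b, Integrable (ψ a b)) :
    Integrable fun y : Fin m → ℝ => (Matrix.of fun a b => ψ a b (y a)).det := by
  simp only [← Matrix.det_transpose (Matrix.of _)]
  simp only [Matrix.det_apply', Matrix.transpose_apply, Matrix.of_apply]
  exact integrable_finsetSum _ fun σ _ =>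
    (Integrable.fintype_prod fun a => h a (σ a)).const_mul _

/-- An integral of a determinant with separated variables in its rows. -/
theorem integral_det {m : ℕ} {ψ : Fin m → Fin m → ℝ → ℝ} (h : ∀ a b, Integrable (ψ a b)) :
    ∫ y : Fin m → ℝ, (Matrix.of fun a b => ψ a b (y a)).det =
      (Matrix.of fun a b => ∫ t, ψ a b t).det := by
  simp only [← Matrix.det_transpose (Matrix.of _)]
  simp only [Matrix.det_apply', Matrix.transpose_apply, Matrix.of_apply]
  rw [integral_finsetSum _ fun σ _ =>
    (Integrable.fintype_prod fun a => h a (σ a)).const_mul _]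
  refine Finset.sum_congr rfl fun σ _ => ?_
  rw [integral_const_mul]
  congr 1
  exact integral_fintype_prod_volume_eq_prod fun a => ψ a (σ a)

/-- The Vandermonde determinant times the Gaussian weight. -/
noncomputable def gaussWeight {m : ℕ} (y : Fin m → ℝ) : ℝ :=
  (Matrix.vandermonde y).det * ∏ i, Real.exp (-(1 / 2) * y i ^ 2)

theorem gaussWeight_eq_det {m : ℕ} (y : Fin m → ℝ) :
    gaussWeight y = (Matrix.of fun a b : Fin m => gaussFun b (y a)).det := by
  have h := Matrix.det_eval_eq y (fun b : Fin m => gaussPoly b) fun b => natDegree_gaussPoly_le b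
  simp only [coeff_gaussPoly, Finset.prod_const_one, one_mul] at h
  rw [gaussWeight, ← h, mul_comm, ← Matrix.det_mul_column]
  congr 1
  ext a b
  simp [gaussFun, mul_comm]

/-- The points up to the upper neighbour of the index `a`, if there is one. -/
def belowSet {m : ℕ} (x : Fin m → ℝ) (a : Fin (m + 1)) : Set ℝ :=
  {t | ∀ i : Fin m, a = i.castSucc → t ≤ x i}

/-- The points between the neighbours of the index `a`. -/
def betweenSet {m : ℕ} (x : Fin m → ℝ) (a : Fin (m + 1)) : Set ℝ :=
  {t | t ∈ belowSet x a ∧ ∀ i : Fin m, a = i.succ → x i ≤ t}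

theorem belowSet_castSucc {m : ℕ} (x : Fin m → ℝ) (i : Fin m) :
    belowSet x i.castSucc = Set.Iic (x i) := by
  ext t
  simp only [belowSet, Set.mem_ofPred_eq, Set.mem_Iic]
  exact ⟨fun h => h i rfl, fun h j hj => by rwa [← Fin.castSucc_injective m hj]⟩

theorem belowSet_last {m : ℕ} (x : Fin m → ℝ) : belowSet x (Fin.last m) = Set.univ := by
  refine Set.eq_univ_of_forall fun t i hi => ?_
  exact absurd hi (Fin.castSucc_lt_last i).ne'

theorem betweenSet_zero {m : ℕ} (x : Fin m → ℝ) : betweenSet x 0 = belowSet x 0 := by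
  ext t
  simp only [betweenSet, Set.mem_ofPred_eq, and_iff_left_iff_imp]
  exact fun _ i hi => absurd hi (Fin.succ_ne_zero i).symm

theorem betweenSet_succ {m : ℕ} (x : Fin m → ℝ) (i : Fin m) :
    betweenSet x i.succ = belowSet x i.succ \ Set.Iio (x i) := by
  ext t
  simp only [betweenSet, Set.mem_ofPred_eq, Set.mem_sdiff, Set.mem_Iio, not_lt]
  exact and_congr_right fun _ =>
    ⟨fun h => h i rfl, fun h j hj => by rwa [← Fin.succ_injective m hj]⟩

theorem measurableSet_belowSet {m : ℕ} (x : Fin m → ℝ) (a : Fin (m + 1)) :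
    MeasurableSet (belowSet x a) := by
  rcases Fin.eq_castSucc_or_eq_last a with ⟨i, rfl⟩ | rfl
  · rw [belowSet_castSucc]
    exact measurableSet_Iic
  · rw [belowSet_last]
    exact MeasurableSet.univ

theorem measurableSet_betweenSet {m : ℕ} (x : Fin m → ℝ) (a : Fin (m + 1)) :
    MeasurableSet (betweenSet x a) := by
  rcases Fin.eq_zero_or_eq_succ a with rfl | ⟨i, rfl⟩
  · rw [betweenSet_zero]
    exact measurableSet_belowSet x 0
  · rw [betweenSet_succ]
    exact (measurableSet_belowSet x _).diff measurableSet_Iio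

theorem Iio_subset_belowSet {m : ℕ} {x : Fin m → ℝ} (hx : Monotone x) (i : Fin m) :
    Set.Iio (x i) ⊆ belowSet x i.succ := by
  intro t ht j hj
  refine (le_of_lt ht).trans (hx ?_)
  have := congrArg Fin.val hj
  simp only [Fin.val_succ, Fin.val_castSucc] at this
  exact Fin.le_def.2 (by omega)

open Classical in
theorem indicator_gaussWeight_eq {m : ℕ} (x : Fin m → ℝ) (y : Fin (m + 1) → ℝ) :
    {y : Fin (m + 1) → ℝ | ∀ a, y a ∈ betweenSet x a}.indicator gaussWeight y =
      (Matrix.of fun a b : Fin (m + 1) =>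
        (betweenSet x a).indicator (gaussFun b) (y a)).det := by
  by_cases h : ∀ a, y a ∈ betweenSet x a
  · rw [Set.indicator_of_mem (by exact h), gaussWeight_eq_det]
    congr 1
    ext a b
    simp only [Matrix.of_apply]
    rw [Set.indicator_of_mem (h a)]
  · rw [Set.indicator_of_notMem (by exact h)]
    push Not at h
    obtain ⟨a, ha⟩ := h
    refine (Matrix.det_eq_zero_of_row_eq_zero a fun b => ?_).symm
    exact Set.indicator_of_notMem ha _

theorem integrable_indicator_gaussWeight {m : ℕ} (x : Fin m → ℝ) :
    Integrable ({y : Fin (m + 1) → ℝ | ∀ a, y a ∈ betweenSet x a}.indicator gaussWeight) := by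
  rw [funext (indicator_gaussWeight_eq x)]
  exact integrable_det fun a b => (integrable_gaussFun b).indicator (measurableSet_betweenSet x a)

/-- Integrating out the points between those of `x` reproduces the Gaussian weight of `x`;
the continuous analogue of `sum_interlaceWeight_mul`. -/
theorem integral_indicator_gaussWeight {m : ℕ} {x : Fin m → ℝ} (hx : Monotone x) :
    ∫ y, {y : Fin (m + 1) → ℝ | ∀ a, y a ∈ betweenSet x a}.indicator gaussWeight y =
      Real.sqrt (2 * Real.pi) * gaussWeight x := by
  simp only [indicator_gaussWeight_eq]
  rw [integral_det (ψ := fun a b => (betweenSet x a).indicator (gaussFun b)) fun a b =>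
    (integrable_gaussFun b).indicator (measurableSet_betweenSet x a)]
  simp only [integral_indicator (measurableSet_betweenSet x _)]
  rw [Matrix.det_increments _ (Matrix.of fun a b : Fin (m + 1) =>
    ∫ t in belowSet x a, gaussFun b t) (Real.sqrt (2 * Real.pi))]
  · simp only [Matrix.of_apply, belowSet_castSucc, Fin.val_succ, integral_Iic_gaussFun_succ]
    have h1 := Matrix.det_mul_column (fun a => Real.exp (-(1 / 2) * x a ^ 2))
      (Matrix.vandermonde x)
    rw [show (Matrix.of fun a b : Fin m => -(x a ^ (b : ℕ) * Real.exp (-(1 / 2) * x a ^ 2))) =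
      (-1 : ℝ) • Matrix.of fun a b : Fin m => Real.exp (-(1 / 2) * x a ^ 2) *
        Matrix.vandermonde x a b by ext a b; simp [Matrix.vandermonde_apply, mul_comm],
      Matrix.det_smul, Fintype.card_fin, h1, gaussWeight]
    have : ((-1 : ℝ)) ^ m * (-1) ^ m = 1 := by rw [← mul_pow]; simp
    linear_combination Real.sqrt (2 * Real.pi) * (∏ i, Real.exp (-(1 / 2) * x i ^ 2)) *
      (Matrix.vandermonde x).det * this
  · intro b
    simp only [Matrix.of_apply, betweenSet_zero]
  · intro i b
    simp only [Matrix.of_apply, betweenSet_succ, belowSet_castSucc]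
    rw [setIntegral_sdiff measurableSet_Iio (integrable_gaussFun b).integrableOn
      (Iio_subset_belowSet hx i), integral_Iic_eq_integral_Iio]
  · simp only [Matrix.of_apply, belowSet_last, setIntegral_univ]
    exact integral_gaussFun_zero
  · intro b
    simp only [Matrix.of_apply, belowSet_last, setIntegral_univ, Fin.val_succ]
    exact integral_gaussFun_succ b

/-! ### The GUE-corners density has mass one -/

namespace TriArray

/-- Appending a level to the index set of triangular arrays. -/
def indexEquiv (m : ℕ) : (Σ ℓ : Fin m, Fin (ℓ.val + 1)) ⊕ Fin (m + 1) ≃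
    Σ ℓ : Fin (m + 1), Fin (ℓ.val + 1) where
  toFun := Sum.elim (fun p => ⟨p.1.castSucc, p.2⟩) fun i => ⟨Fin.last m, i⟩
  invFun p := if h : p.1.val < m then Sum.inl ⟨⟨p.1.val, h⟩, p.2⟩
    else Sum.inr ⟨p.2.val, by have := p.2.isLt; have := p.1.isLt; omega⟩
  left_inv := by
    rintro (⟨ℓ, i⟩ | i)
    · simp
    · simp
  right_inv := by
    rintro ⟨⟨ℓ, hℓ⟩, i⟩
    by_cases h : ℓ < m
    · simp [h]
    · obtain rfl : ℓ = m := by omega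
      simp [Fin.last]

/-- Appending the level `y` to the triangular array `z`, as a measurable equivalence. -/
noncomputable def append (m : ℕ) : (TriArray m × (Fin (m + 1) → ℝ)) ≃ᵐ TriArray (m + 1) :=
  (MeasurableEquiv.sumPiEquivProdPi fun _ => ℝ).symm.trans
    (MeasurableEquiv.piCongrLeft (fun _ => ℝ) (indexEquiv m))

theorem measurePreserving_append (m : ℕ) : MeasurePreserving (append m) :=
  (volume_measurePreserving_sumPiEquivProdPi_symm fun _ => ℝ).trans
    (volume_measurePreserving_piCongrLeft (fun _ => ℝ) (indexEquiv m))

theorem append_entry_of_lt {m : ℕ} (z : TriArray m) (y : Fin (m + 1) → ℝ) {ℓ i : ℕ}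
    (hℓ : ℓ < m) (hi : i < ℓ + 1) (hℓ' : ℓ < m + 1) :
    (append m (z, y)).entry ℓ i hℓ' hi = z.entry ℓ i hℓ hi :=
  MeasurableEquiv.piCongrLeft_apply_apply (β := fun _ => ℝ) (indexEquiv m)
    ((MeasurableEquiv.sumPiEquivProdPi fun _ => ℝ).symm (z, y)) (Sum.inl ⟨⟨ℓ, hℓ⟩, ⟨i, hi⟩⟩)

theorem append_entry_last {m : ℕ} (z : TriArray m) (y : Fin (m + 1) → ℝ) {i : ℕ}
    (hi : i < m + 1) (hm : m < m + 1) : (append m (z, y)).entry m i hm hi = y ⟨i, hi⟩ :=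
  MeasurableEquiv.piCongrLeft_apply_apply (β := fun _ => ℝ) (indexEquiv m)
    ((MeasurableEquiv.sumPiEquivProdPi fun _ => ℝ).symm (z, y)) (Sum.inr ⟨i, hi⟩)

theorem append_lastLevel {m : ℕ} (z : TriArray m) (y : Fin (m + 1) → ℝ) :
    (append m (z, y)).lastLevel = y :=
  funext fun i => append_entry_last z y i.isLt _

theorem Interlaced.strictMono_lastLevel {m : ℕ} {z : TriArray m} (hz : z.Interlaced) :
    StrictMono z.lastLevel := by
  rcases m with _ | m
  · exact fun i => i.elim0
  · rw [Fin.strictMono_iff_lt_succ]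
    intro i
    exact hz.1 m i (by omega) (by have := i.isLt; omega)

theorem interlaced_append_iff {m : ℕ} (z : TriArray m) (y : Fin (m + 1) → ℝ) :
    (append m (z, y)).Interlaced ↔
      z.Interlaced ∧ StrictMono y ∧ ∀ a, y a ∈ betweenSet z.lastLevel a := by
  constructor
  · intro h
    refine ⟨⟨fun ℓ i hℓ hi => ?_, fun ℓ i hℓ hi => ?_⟩, ?_, fun a => ⟨fun i hi => ?_, fun i hi => ?_⟩⟩
    · have := h.1 ℓ i (by omega) hi
      rwa [append_entry_of_lt z y hℓ, append_entry_of_lt z y hℓ] at this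
    · have := h.2 ℓ i (by omega) hi
      rwa [append_entry_of_lt z y hℓ, append_entry_of_lt z y hℓ,
        append_entry_of_lt z y (by omega)] at this
    · have := h.strictMono_lastLevel
      rwa [append_lastLevel] at this
    · subst hi
      obtain ⟨m, rfl⟩ : ∃ k, m = k + 1 := ⟨m - 1, by have := i.isLt; omega⟩
      have := (h.2 m i (by omega) i.isLt).1
      rwa [append_entry_of_lt z y (ℓ := m) (by omega), append_entry_last] at this
    · subst hi
      obtain ⟨m, rfl⟩ : ∃ k, m = k + 1 := ⟨m - 1, by have := i.isLt; omega⟩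
      have := (h.2 m i (by omega) i.isLt).2
      rwa [append_entry_of_lt z y (ℓ := m) (by omega), append_entry_last] at this
  · rintro ⟨h1, h2, h3⟩
    refine ⟨fun ℓ i hℓ hi => ?_, fun ℓ i hℓ hi => ?_⟩
    · rcases Nat.eq_or_lt_of_le (Nat.lt_succ_iff.1 hℓ) with rfl | hlt
      · rw [append_entry_last, append_entry_last]
        exact h2 (Fin.mk_lt_mk.2 (Nat.lt_succ_self i))
      · rw [append_entry_of_lt z y hlt, append_entry_of_lt z y hlt]
        exact h1.1 ℓ i hlt hi
    · rcases Nat.eq_or_lt_of_le (Nat.lt_succ_iff.1 hℓ) with rfl | hlt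
      · rw [append_entry_last, append_entry_last, append_entry_of_lt z y (by omega)]
        exact ⟨(h3 ⟨i, by omega⟩).1 ⟨i, hi⟩ rfl, (h3 ⟨i + 1, by omega⟩).2 ⟨i, hi⟩ rfl⟩
      · rw [append_entry_of_lt z y hlt, append_entry_of_lt z y hlt,
          append_entry_of_lt z y (by omega)]
        exact h1.2 ℓ i hlt hi

theorem measurableSet_interlaced (m : ℕ) : MeasurableSet {z : TriArray m | z.Interlaced} := by
  have hm : ∀ (ℓ i : ℕ) (hℓ : ℓ < m) (hi : i < ℓ + 1),
      Measurable fun z : TriArray m => z.entry ℓ i hℓ hi := fun ℓ i hℓ hi => measurable_pi_apply _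
  simp only [Interlaced, Set.ofPred_and, Set.ofPred_forall]
  refine MeasurableSet.inter ?_ ?_
  · exact .iInter fun ℓ => .iInter fun i => .iInter fun hℓ => .iInter fun hi =>
      measurableSet_lt (hm _ _ _ _) (hm _ _ _ _)
  · exact .iInter fun ℓ => .iInter fun i => .iInter fun hℓ => .iInter fun hi =>
      (measurableSet_le (hm _ _ _ _) (hm _ _ _ _)).inter
        (measurableSet_le (hm _ _ _ _) (hm _ _ _ _))

theorem continuous_lastLevel (m : ℕ) : Continuous (lastLevel : TriArray m → Fin m → ℝ) :=
  continuous_pi fun _ => continuous_apply _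

end TriArray

theorem continuous_vandermonde_det (m : ℕ) :
    Continuous fun y : Fin m → ℝ => (Matrix.vandermonde y).det := by
  refine Continuous.matrix_det (continuous_pi fun i => continuous_pi fun j => ?_)
  exact (continuous_apply i).pow _

theorem continuous_gaussWeight (m : ℕ) : Continuous (gaussWeight : (Fin m → ℝ) → ℝ) := by
  refine (continuous_vandermonde_det m).mul (continuous_finsetProd _ fun i _ => ?_)
  fun_prop

theorem vandermonde_det_nonneg {m : ℕ} {y : Fin m → ℝ} (hy : Monotone y) :
    0 ≤ (Matrix.vandermonde y).det := by
  rw [Matrix.det_vandermonde]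
  refine Finset.prod_nonneg fun i _ => Finset.prod_nonneg fun j hj => ?_
  exact sub_nonneg.2 (hy (Finset.mem_Ioi.1 hj).le)

theorem gaussWeight_nonneg {m : ℕ} {y : Fin m → ℝ} (hy : Monotone y) : 0 ≤ gaussWeight y :=
  mul_nonneg (vandermonde_det_nonneg hy) (Finset.prod_nonneg fun _ _ => (Real.exp_pos _).le)

theorem gaussWeight_eq_zero {m : ℕ} {y : Fin m → ℝ} (hy : ¬ Function.Injective y) :
    gaussWeight y = 0 := by
  rw [gaussWeight, not_ne_iff.1 (mt Matrix.det_vandermonde_ne_zero_iff.1 hy), zero_mul]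

open Classical in
theorem gueCornersDensity_eq (m : ℕ) (z : TriArray m) : gueCornersDensity m z =
    if z.Interlaced then 1 / (2 * Real.pi) ^ ((m : ℝ) / 2) * gaussWeight z.lastLevel else 0 := by
  rw [gueCornersDensity, gaussWeight]
  split_ifs
  · ring
  · rfl

theorem measurable_gueCornersDensity (m : ℕ) : Measurable (gueCornersDensity m) := by
  classical
  rw [funext (gueCornersDensity_eq m)]
  refine Measurable.ite (TriArray.measurableSet_interlaced m) ?_ measurable_const
  exact (((continuous_gaussWeight m).comp (TriArray.continuous_lastLevel m)).measurable).const_mul _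

theorem monotone_of_mem_betweenSet {m : ℕ} {x : Fin m → ℝ} {y : Fin (m + 1) → ℝ}
    (h : ∀ a, y a ∈ betweenSet x a) : Monotone y := by
  rw [Fin.monotone_iff_le_succ]
  exact fun i => ((h i.castSucc).1 i rfl).trans ((h i.succ).2 i rfl)

/-- The GUE-corners densities are consistent: the last level can be integrated out. -/
theorem lintegral_gueCornersDensity_append {m : ℕ} (z : TriArray m) :
    ∫⁻ y, ENNReal.ofReal (gueCornersDensity (m + 1) (TriArray.append m (z, y))) =
      ENNReal.ofReal (gueCornersDensity m z) := by
  classical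
  simp only [gueCornersDensity_eq, TriArray.interlaced_append_iff, TriArray.append_lastLevel]
  by_cases hz : z.Interlaced
  swap
  · simp [hz]
  simp only [hz, true_and, if_true]
  have hx := hz.strictMono_lastLevel.monotone
  have hc : ∀ k : ℕ, 0 < 1 / (2 * Real.pi) ^ ((k : ℝ) / 2) := fun k => by positivity
  -- On the boundary, where two points of the new level coincide, the weight vanishes.
  have h1 : ∀ y : Fin (m + 1) → ℝ,
      (if StrictMono y ∧ ∀ a, y a ∈ betweenSet z.lastLevel a then
        1 / (2 * Real.pi) ^ (((m + 1 : ℕ) : ℝ) / 2) * gaussWeight y else 0) =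
      1 / (2 * Real.pi) ^ (((m + 1 : ℕ) : ℝ) / 2) *
        {y : Fin (m + 1) → ℝ | ∀ a, y a ∈ betweenSet z.lastLevel a}.indicator gaussWeight y := by
    intro y
    by_cases hB : ∀ a, y a ∈ betweenSet z.lastLevel a
    · rw [Set.indicator_of_mem (by exact hB)]
      by_cases hs : StrictMono y
      · rw [if_pos ⟨hs, hB⟩]
      · rw [if_neg fun h => hs h.1, gaussWeight_eq_zero, mul_zero]
        exact fun hi => hs ((monotone_of_mem_betweenSet hB).strictMono_of_injective hi)
    · rw [Set.indicator_of_notMem (by exact hB), if_neg fun h => hB h.2, mul_zero]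
  simp only [h1]
  rw [← ofReal_integral_eq_lintegral_ofReal
    ((integrable_indicator_gaussWeight z.lastLevel).const_mul _), integral_const_mul,
    integral_indicator_gaussWeight hx]
  · congr 1
    have h2 : (2 * Real.pi) ^ (((m + 1 : ℕ) : ℝ) / 2) =
        (2 * Real.pi) ^ ((m : ℝ) / 2) * Real.sqrt (2 * Real.pi) := by
      rw [Real.sqrt_eq_rpow, ← Real.rpow_add (by positivity)]
      congr 1
      push_cast
      ring
    have h3 : Real.sqrt (2 * Real.pi) ≠ 0 := by positivity
    have h4 : (2 * Real.pi) ^ ((m : ℝ) / 2) ≠ 0 := by positivity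
    rw [h2]
    field_simp
  · refine Eventually.of_forall fun y => mul_nonneg (hc _).le ?_
    refine Set.indicator_nonneg (fun y hy => ?_) y
    exact gaussWeight_nonneg (monotone_of_mem_betweenSet hy)

theorem lintegral_gueCornersDensity (m : ℕ) :
    ∫⁻ z, ENNReal.ofReal (gueCornersDensity m z) = 1 := by
  induction m with
  | zero =>
    have h : ∀ z : TriArray 0, gueCornersDensity 0 z = 1 := by
      intro z
      rw [gueCornersDensity_eq, if_pos ⟨fun ℓ _ hℓ => absurd hℓ (by omega),
        fun ℓ _ hℓ => absurd hℓ (by omega)⟩]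
      simp [gaussWeight]
    simp [h, volume_pi]
  | succ m ih =>
    have hm := (measurable_gueCornersDensity (m + 1)).ennreal_ofReal
    have hm' : Measurable fun p => ENNReal.ofReal
        (gueCornersDensity (m + 1) (TriArray.append m p)) := hm.comp (TriArray.append m).measurable
    rw [← (TriArray.measurePreserving_append m).lintegral_comp hm, Measure.volume_eq_prod,
      lintegral_prod _ hm'.aemeasurable]
    simp only [lintegral_gueCornersDensity_append]
    exact ih

theorem isProbabilityMeasure_gueCorners (m : ℕ) : IsProbabilityMeasure (gueCorners m) := by
  constructor
  rw [gueCorners, withDensity_apply _ MeasurableSet.univ, setLIntegral_univ]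
  exact lintegral_gueCornersDensity m

/-! ### The local limit of binomial weights -/

theorem abs_mul_log_sub_le {v : ℝ} (hv : |v| ≤ 1 / 2) :
    |(1 + v) * Real.log (1 + v) - v - v ^ 2 / 2| ≤ 4 * |v| ^ 3 := by
  have h := Real.abs_log_sub_add_sum_range_le (x := -v) (by rw [abs_neg]; linarith) 2
  rw [Finset.sum_range_succ, Finset.sum_range_succ, Finset.sum_range_zero, abs_neg,
    sub_neg_eq_add] at h
  have hR : |Real.log (1 + v) - v + v ^ 2 / 2| ≤ 2 * |v| ^ 3 := by
    have e : Real.log (1 + v) - v + v ^ 2 / 2 = 0 + (-v) ^ (0 + 1) / ((0 : ℕ) + 1) +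
        (-v) ^ (1 + 1) / ((1 : ℕ) + 1) + Real.log (1 + v) := by
      push_cast
      ring
    rw [e]
    refine h.trans ?_
    rw [div_le_iff₀ (by linarith)]
    have := mul_nonneg (pow_nonneg (abs_nonneg v) 3) (sub_nonneg.2 hv)
    norm_num
    linarith
  have e : (1 + v) * Real.log (1 + v) - v - v ^ 2 / 2 =
      (1 + v) * (Real.log (1 + v) - v + v ^ 2 / 2) - v ^ 3 / 2 := by ring
  rw [e]
  have h1 : |1 + v| ≤ 3 / 2 := by
    refine (abs_add_le 1 v).trans ?_
    rw [abs_one]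
    linarith
  have h2 : |v ^ 3 / 2| = |v| ^ 3 / 2 := by
    rw [abs_div, abs_pow, abs_two]
  refine (abs_sub _ _).trans ?_
  rw [abs_mul, h2]
  have h3 := mul_le_mul h1 hR (abs_nonneg _) (by norm_num)
  linarith [pow_nonneg (abs_nonneg v) 3]

/-- Second-order expansion of the entropy term `(a n + t) log ((a n + t) / (a n))` for `t` of order
`√n`. -/
theorem tendsto_mul_log_sub {a τ : ℝ} (ha : 0 < a) {t : ℕ → ℝ}
    (ht : Tendsto (fun n : ℕ => t n / Real.sqrt n) atTop (𝓝 τ)) :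
    Tendsto (fun n : ℕ => (a * n + t n) * Real.log ((a * n + t n) / (a * n)) - t n) atTop
      (𝓝 (τ ^ 2 / (2 * a))) := by
  have hsqrt : Tendsto (fun n : ℕ => Real.sqrt n) atTop atTop :=
    Real.tendsto_sqrt_atTop.comp tendsto_natCast_atTop_atTop
  have hinv : Tendsto (fun n : ℕ => (Real.sqrt n)⁻¹) atTop (𝓝 0) := tendsto_inv_atTop_zero.comp hsqrt
  have hv : Tendsto (fun n : ℕ => t n / (a * n)) atTop (𝓝 0) := by
    have h := (ht.mul hinv).const_mul a⁻¹
    rw [mul_zero, mul_zero] at h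
    refine h.congr fun n => ?_
    have : Real.sqrt n * Real.sqrt n = n := Real.mul_self_sqrt n.cast_nonneg
    rw [← this]
    simp only [div_eq_mul_inv, mul_inv]
    rw [this]
    ring
  have hmain : Tendsto (fun n : ℕ => (t n / Real.sqrt n) ^ 2 / (2 * a)) atTop
      (𝓝 (τ ^ 2 / (2 * a))) := (ht.pow 2).div_const _
  have herr : Tendsto (fun n : ℕ => 4 / a ^ 2 * (|t n / Real.sqrt n| ^ 3 * (Real.sqrt n)⁻¹)) atTop
      (𝓝 0) := by
    have h := ((ht.abs.pow 3).mul hinv).const_mul (4 / a ^ 2)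
    rwa [mul_zero, mul_zero] at h
  have hdiff : Tendsto (fun n : ℕ => ((a * n + t n) * Real.log ((a * n + t n) / (a * n)) - t n) -
      (t n / Real.sqrt n) ^ 2 / (2 * a)) atTop (𝓝 0) := by
    refine squeeze_zero_norm' ?_ herr
    have hsmall : ∀ᶠ n : ℕ in atTop, |t n / (a * n)| < 1 / 2 := by
      have := hv.abs
      rw [abs_zero] at this
      exact this.eventually_lt_const (by norm_num)
    filter_upwards [hsmall, eventually_gt_atTop 0] with n hn hn0
    have hn0' : (0 : ℝ) < n := by exact_mod_cast hn0
    have hs : 0 < Real.sqrt n := Real.sqrt_pos.2 hn0'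
    have hss : Real.sqrt n ^ 2 = n := Real.sq_sqrt hn0'.le
    have h := abs_mul_log_sub_le hn.le
    have e1 : (a * n + t n) / (a * n) = 1 + t n / (a * n) := by
      rw [add_div, div_self (by positivity)]
    have e2 : ((a * n + t n) * Real.log ((a * n + t n) / (a * n)) - t n) -
        (t n / Real.sqrt n) ^ 2 / (2 * a) = a * n * ((1 + t n / (a * n)) *
          Real.log (1 + t n / (a * n)) - t n / (a * n) - (t n / (a * n)) ^ 2 / 2) := by
      rw [e1, div_pow, hss]
      field_simp
    rw [e2, Real.norm_eq_abs, abs_mul, abs_of_pos (by positivity : 0 < a * n)]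
    refine (mul_le_mul_of_nonneg_left h (by positivity)).trans_eq ?_
    rw [abs_div, abs_div, abs_of_pos (by positivity : 0 < a * n), abs_of_pos hs]
    have hsn : (n : ℝ) = Real.sqrt n ^ 2 := hss.symm
    rw [hsn]
    rw [Real.sqrt_sq hs.le]
    field_simp
  have := hdiff.add hmain
  rw [zero_add] at this
  exact this.congr fun n => by ring

theorem factorial_eq_stirlingSeq {n : ℕ} (hn : 0 < n) : (n.factorial : ℝ) =
    Stirling.stirlingSeq n * (Real.sqrt (2 * n) * (n / Real.exp 1) ^ n) := by
  have : (0 : ℝ) < n := by exact_mod_cast hn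
  rw [Stirling.stirlingSeq, div_mul_cancel₀]
  positivity

/-- A binomial probability in terms of the Stirling sequence and relative entropies. -/
theorem choose_mul_eq {p q : ℝ} (hp : 0 < p) (hq : 0 < q) {n k : ℕ} (hk : 0 < k) (hkn : k < n) :
    (n.choose k : ℝ) * (p ^ k * q ^ (n - k)) =
      Stirling.stirlingSeq n / (Stirling.stirlingSeq k * Stirling.stirlingSeq (n - k)) *
      (Real.sqrt (2 * n) / (Real.sqrt (2 * k) * Real.sqrt (2 * (n - k : ℕ)))) *
      Real.exp (-(k * Real.log (k / (p * n)) + (n - k : ℕ) *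
        Real.log ((n - k : ℕ) / (q * n)))) := by
  obtain ⟨l, rfl⟩ : ∃ l, n = k + l := ⟨n - k, by omega⟩
  have hl : 0 < l := by omega
  rw [Nat.add_sub_cancel_left, Nat.cast_choose ℝ (Nat.le_add_right k l), Nat.add_sub_cancel_left,
    factorial_eq_stirlingSeq hk, factorial_eq_stirlingSeq hl, factorial_eq_stirlingSeq (by omega)]
  have hk' : (0 : ℝ) < k := by exact_mod_cast hk
  have hl' : (0 : ℝ) < l := by exact_mod_cast hl
  have hn' : (0 : ℝ) < ((k + l : ℕ) : ℝ) := by push_cast; positivity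
  have h1 : Stirling.stirlingSeq k ≠ 0 := by rw [Stirling.stirlingSeq]; positivity
  have h2 : Stirling.stirlingSeq l ≠ 0 := by rw [Stirling.stirlingSeq]; positivity
  have e1 : Real.exp (-(k * Real.log (k / (p * (k + l : ℕ))) + l *
      Real.log (l / (q * (k + l : ℕ))))) =
      ((p * (k + l : ℕ)) / k) ^ k * ((q * (k + l : ℕ)) / l) ^ l := by
    rw [neg_add, Real.exp_add, ← mul_neg, ← mul_neg, ← Real.log_inv, ← Real.log_inv, inv_div,
      inv_div, Real.exp_nat_mul, Real.exp_nat_mul, Real.exp_log (by positivity),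
      Real.exp_log (by positivity)]
  rw [e1]
  set N : ℝ := ((k + l : ℕ) : ℝ)
  simp only [div_pow, mul_pow, pow_add]
  have he : Real.exp 1 ≠ 0 := (Real.exp_pos 1).ne'
  have h3 : Real.sqrt (2 * k) ≠ 0 := by positivity
  have h4 : Real.sqrt (2 * l) ≠ 0 := by positivity
  field_simp

/-- The local central limit theorem for the binomial distribution with `p = lam / (1 + lam)`. -/
theorem tendsto_binomial {lam : ℝ} (hlam : 0 < lam) {k : ℕ → ℕ} {z : ℝ}
    (hk : Tendsto (fun n : ℕ => ((k n : ℝ) - n * lam / (1 + lam)) /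
      Real.sqrt (n * lam / (1 + lam) ^ 2)) atTop (𝓝 z)) :
    Tendsto (fun n : ℕ => Real.sqrt (n * lam / (1 + lam) ^ 2) *
      (lam ^ k n * (n.choose (k n) : ℝ) / (1 + lam) ^ n)) atTop
      (𝓝 (Real.exp (-(1 / 2) * z ^ 2) / Real.sqrt (2 * Real.pi))) := by
  have hl1 : 0 < 1 + lam := by positivity
  obtain ⟨p, hp⟩ : ∃ p, p = lam / (1 + lam) := ⟨_, rfl⟩
  obtain ⟨q, hq⟩ : ∃ q, q = 1 / (1 + lam) := ⟨_, rfl⟩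
  have hp0 : 0 < p := by rw [hp]; positivity
  have hq0 : 0 < q := by rw [hq]; positivity
  have hpq : p + q = 1 := by rw [hp, hq]; field_simp; ring
  have hσ : ∀ n : ℕ, Real.sqrt (n * lam / (1 + lam) ^ 2) = Real.sqrt n * Real.sqrt (p * q) := by
    intro n
    rw [← Real.sqrt_mul n.cast_nonneg, hp, hq]
    congr 1
    field_simp
  have hμ : ∀ n : ℕ, (n : ℝ) * lam / (1 + lam) = p * n := fun n => by rw [hp]; ring
  have hs0 : 0 < Real.sqrt (p * q) := Real.sqrt_pos.2 (by positivity)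
  simp only [hσ, hμ] at hk ⊢
  -- The deviation `t` of `k` from the mean, on the scale `√n`.
  obtain ⟨t, ht⟩ : ∃ t : ℕ → ℝ, ∀ n, t n = k n - p * n := ⟨_, fun _ => rfl⟩
  have htlim : Tendsto (fun n : ℕ => t n / Real.sqrt n) atTop (𝓝 (z * Real.sqrt (p * q))) := by
    refine (hk.mul_const (Real.sqrt (p * q))).congr fun n => ?_
    rw [ht, div_mul_eq_div_div, div_mul_cancel₀ _ hs0.ne']
  have hsqrt : Tendsto (fun n : ℕ => Real.sqrt n) atTop atTop :=
    Real.tendsto_sqrt_atTop.comp tendsto_natCast_atTop_atTop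
  have hinv : Tendsto (fun n : ℕ => (Real.sqrt n)⁻¹) atTop (𝓝 0) := tendsto_inv_atTop_zero.comp hsqrt
  have htn : Tendsto (fun n : ℕ => t n / n) atTop (𝓝 0) := by
    have h := htlim.mul hinv
    rw [mul_zero] at h
    refine h.congr fun n => ?_
    rw [div_eq_mul_inv, mul_assoc, ← mul_inv, Real.mul_self_sqrt n.cast_nonneg, div_eq_mul_inv]
  have hkn : Tendsto (fun n : ℕ => (k n : ℝ) / n) atTop (𝓝 p) := by
    have h := htn.add_const p
    rw [zero_add] at h
    refine h.congr' ?_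
    filter_upwards [eventually_gt_atTop 0] with n hn
    have : (n : ℝ) ≠ 0 := by exact_mod_cast hn.ne'
    rw [ht]
    field_simp
    ring
  have hev : ∀ᶠ n : ℕ in atTop, 0 < n ∧ 0 < k n ∧ k n < n := by
    filter_upwards [hkn.eventually_const_lt hp0,
      hkn.eventually_lt_const (by linarith : p < 1), eventually_gt_atTop 0] with n h1 h2 h3
    have h3' : (0 : ℝ) < n := by exact_mod_cast h3
    refine ⟨h3, ?_, ?_⟩
    · exact_mod_cast (div_pos_iff_of_pos_right h3').1 h1
    · rw [div_lt_one h3'] at h2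
      exact_mod_cast h2
  have hln : Tendsto (fun n : ℕ => ((n - k n : ℕ) : ℝ) / n) atTop (𝓝 q) := by
    have h := hkn.const_sub 1
    rw [← hpq, add_sub_cancel_left] at h
    refine h.congr' ?_
    filter_upwards [hev] with n ⟨h1, h2, h3⟩
    have : (n : ℝ) ≠ 0 := by exact_mod_cast h1.ne'
    rw [Nat.cast_sub h3.le, sub_div, div_self this, hpq]
  have hcast : Tendsto (fun n : ℕ => (n : ℝ)) atTop atTop := tendsto_natCast_atTop_atTop
  have hktop : Tendsto k atTop atTop := by
    rw [← tendsto_natCast_atTop_iff (R := ℝ)]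
    refine (hcast.atTop_mul_pos hp0 hkn).congr' ?_
    filter_upwards [eventually_gt_atTop 0] with n hn
    have : (n : ℝ) ≠ 0 := by exact_mod_cast hn.ne'
    field_simp
  have hltop : Tendsto (fun n => n - k n) atTop atTop := by
    rw [← tendsto_natCast_atTop_iff (R := ℝ)]
    refine (hcast.atTop_mul_pos hq0 hln).congr' ?_
    filter_upwards [eventually_gt_atTop 0] with n hn
    have : (n : ℝ) ≠ 0 := by exact_mod_cast hn.ne'
    field_simp
  have hS := Stirling.tendsto_stirlingSeq_sqrt_pi
  have hπ : Real.sqrt Real.pi ≠ 0 := by positivity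
  have f1 := hS.div ((hS.comp hktop).mul (hS.comp hltop)) (mul_ne_zero hπ hπ)
  have f2 : Tendsto (fun n : ℕ => Real.sqrt (p * q) / (Real.sqrt (k n / n) *
      Real.sqrt ((n - k n : ℕ) / n) * Real.sqrt 2)) atTop
      (𝓝 (Real.sqrt (p * q) / (Real.sqrt p * Real.sqrt q * Real.sqrt 2))) := by
    refine tendsto_const_nhds.div ((hkn.sqrt.mul hln.sqrt).mul_const _) ?_
    positivity
  have f3 := ((tendsto_mul_log_sub hp0 htlim).add (tendsto_mul_log_sub hq0 (t := fun n => -t n)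
    (τ := -(z * Real.sqrt (p * q))) (by simpa only [neg_div] using htlim.neg))).neg.rexp
  have f := (f1.mul f2).mul f3
  have hlim : Real.sqrt Real.pi / (Real.sqrt Real.pi * Real.sqrt Real.pi) *
      (Real.sqrt (p * q) / (Real.sqrt p * Real.sqrt q * Real.sqrt 2)) *
      Real.exp (-((z * Real.sqrt (p * q)) ^ 2 / (2 * p) +
        (-(z * Real.sqrt (p * q))) ^ 2 / (2 * q))) =
      Real.exp (-(1 / 2) * z ^ 2) / Real.sqrt (2 * Real.pi) := by
    have e : -((z * Real.sqrt (p * q)) ^ 2 / (2 * p) +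
        (-(z * Real.sqrt (p * q))) ^ 2 / (2 * q)) = -(1 / 2) * z ^ 2 := by
      rw [neg_sq, mul_pow, Real.sq_sqrt (by positivity)]
      field_simp
      linear_combination (-z ^ 2) * hpq
    rw [e, Real.sqrt_mul hp0.le, Real.sqrt_mul (by norm_num)]
    have := Real.sqrt_pos.2 hp0
    have := Real.sqrt_pos.2 hq0
    field_simp
  rw [hlim] at f
  refine f.congr' ?_
  filter_upwards [hev] with n ⟨h1, h2, h3⟩
  have hn0 : (0 : ℝ) < n := by exact_mod_cast h1
  have hk0 : (0 : ℝ) < k n := by exact_mod_cast h2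
  have hl0 : (0 : ℝ) < (n - k n : ℕ) := by exact_mod_cast Nat.sub_pos_of_lt h3
  have hpk : lam ^ k n * (n.choose (k n) : ℝ) / (1 + lam) ^ n =
      (n.choose (k n) : ℝ) * (p ^ k n * q ^ (n - k n)) := by
    have : (1 + lam) ^ n = (1 + lam) ^ k n * (1 + lam) ^ (n - k n) := by
      rw [← pow_add, Nat.add_sub_cancel' h3.le]
    rw [hp, hq, this, div_pow, div_pow, one_pow]
    field_simp
  have e1 : p * n + t n = k n := by rw [ht]; ring
  have e2 : q * n + -t n = (n - k n : ℕ) := by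
    rw [ht, Nat.cast_sub h3.le]
    linear_combination (n : ℝ) * hpq
  rw [hpk, choose_mul_eq hp0 hq0 h2 h3]
  simp only [Pi.div_apply, Function.comp_apply]
  rw [e1, e2]
  have e3 : Real.sqrt (p * q) / (Real.sqrt (k n / n) * Real.sqrt ((n - k n : ℕ) / n) *
      Real.sqrt 2) = Real.sqrt n * Real.sqrt (p * q) *
      (Real.sqrt (2 * n) / (Real.sqrt (2 * k n) * Real.sqrt (2 * (n - k n : ℕ)))) := by
    rw [Real.sqrt_div hk0.le, Real.sqrt_div hl0.le, Real.sqrt_mul (by norm_num : (0 : ℝ) ≤ 2) n,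
      Real.sqrt_mul (by norm_num : (0 : ℝ) ≤ 2) (k n), Real.sqrt_mul (by norm_num : (0 : ℝ) ≤ 2)]
    have := Real.sqrt_pos.2 hn0
    have := Real.sqrt_pos.2 hk0
    have := Real.sqrt_pos.2 hl0
    field_simp
  rw [e3]
  have e4 : -(k n * Real.log (k n / (p * n)) - t n + ((n - k n : ℕ) *
      Real.log ((n - k n : ℕ) / (q * n)) - -t n)) = -(k n * Real.log (k n / (p * n)) +
      (n - k n : ℕ) * Real.log ((n - k n : ℕ) / (q * n))) := by ring
  rw [e4]
  ring

/-! ### The local limit of the weight of a level -/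

namespace AztecDiamond

/-- The centring `μ` of the particles. -/
noncomputable def centre (lam : ℝ) (n : ℕ) : ℝ := n * lam / (1 + lam)

/-- The scale `σ` of the particles. -/
noncomputable def scale (lam : ℝ) (n : ℕ) : ℝ := Real.sqrt (n * lam / (1 + lam) ^ 2)

theorem scale_sq {lam : ℝ} (hlam : 0 < lam) (n : ℕ) :
    scale lam n ^ 2 = n * lam / (1 + lam) ^ 2 :=
  Real.sq_sqrt (by positivity)

theorem scale_pos {lam : ℝ} (hlam : 0 < lam) {n : ℕ} (hn : 0 < n) : 0 < scale lam n :=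
  Real.sqrt_pos.2 (by positivity)

theorem tendsto_scale {lam : ℝ} (hlam : 0 < lam) : Tendsto (scale lam) atTop atTop := by
  refine Real.tendsto_sqrt_atTop.comp ?_
  refine Tendsto.atTop_div_const (by positivity) ?_
  exact tendsto_natCast_atTop_atTop.atTop_mul_const hlam

theorem tendsto_centre_add {lam : ℝ} (hlam : 0 < lam) (z : ℝ) :
    Tendsto (fun n => centre lam n + scale lam n * z) atTop atTop := by
  have h : ∀ n, centre lam n + scale lam n * z =
      scale lam n * (scale lam n * (1 + lam) + z) := by
    intro n
    have h1 : centre lam n = scale lam n ^ 2 * (1 + lam) := by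
      rw [scale_sq hlam, centre]
      field_simp
    rw [h1]
    ring
  simp only [h]
  refine (tendsto_scale hlam).atTop_mul_atTop₀ ?_
  exact tendsto_atTop_add_const_right _ _ ((tendsto_scale hlam).atTop_mul_const (by positivity))

/-- The factors of the product in `levelConst` are asymptotic to `σ ^ 2 * (1 + lam)`. -/
theorem tendsto_scale_sq_div {lam : ℝ} (hlam : 0 < lam) (b : ℕ) :
    Tendsto (fun n : ℕ => scale lam n ^ 2 * (1 + lam) / (lam * ((n : ℝ) - b) / (1 + lam))) atTop
      (𝓝 1) := by
  have h1 : Tendsto (fun n : ℕ => (1 - (b : ℝ) / n)⁻¹) atTop (𝓝 1) := by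
    have := ((tendsto_const_div_atTop_nhds_zero_nat (b : ℝ)).const_sub 1).inv₀ (by simp)
    simpa using this
  refine h1.congr' ?_
  filter_upwards [eventually_gt_atTop b] with n hn
  have h2 : (b : ℝ) < n := by exact_mod_cast hn
  have h3 : (n : ℝ) - b ≠ 0 := by linarith
  have h4 : (n : ℝ) ≠ 0 := by
    have : (0 : ℝ) ≤ b := b.cast_nonneg
    linarith
  rw [scale_sq hlam, one_sub_div h4]
  field_simp

theorem det_vandermonde_rescale (m : ℕ) (y : Fin m → ℝ) (c s : ℝ) (hs : s ≠ 0) :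
    (Matrix.vandermonde y).det =
      (∏ j ∈ Finset.range m, s ^ j) * (Matrix.vandermonde fun i => (y i - c) / s).det := by
  rw [← Matrix.det_vandermonde_sub y c, ← Fin.prod_univ_eq_prod_range (fun j => s ^ j),
    ← Matrix.det_mul_row]
  congr 1
  ext i j
  rw [Matrix.of_apply, Matrix.vandermonde_apply, Matrix.vandermonde_apply, ← mul_pow,
    mul_div_cancel₀ _ hs]

/-- The local limit of the weight of separated levels, whose interlacing weights are all `1 + lam`:
each point of the last level contributes a binomial weight, and the remaining powers of `σ` rescale
the Vandermonde determinant and cancel the products in `levelConst`. -/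
theorem tendsto_krawtchoukWeight {lam : ℝ} (hlam : 0 < lam) {m : ℕ} {k : ℕ → Fin m → ℕ}
    {y : Fin m → ℝ}
    (hk : ∀ i, Tendsto (fun n => ((k n i : ℝ) - centre lam n) / scale lam n) atTop (𝓝 (y i))) :
    Tendsto (fun n => (∏ j ∈ Finset.range m, scale lam n ^ (j + 1)) *
      ((∏ j ∈ Finset.range m, (1 + lam) ^ j) * krawtchoukWeight lam n (k n) /
        ∏ l ∈ Finset.range m, levelConst lam n l)) atTop
      (𝓝 (1 / (2 * Real.pi) ^ ((m : ℝ) / 2) * gaussWeight y)) := by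
  have h1 : Tendsto (fun n => (Matrix.vandermonde fun i =>
      ((k n i : ℝ) - centre lam n) / scale lam n).det) atTop (𝓝 (Matrix.vandermonde y).det) :=
    ((continuous_vandermonde_det m).tendsto y).comp (tendsto_pi_nhds.2 hk)
  have h2 : Tendsto (fun n => ∏ i, (scale lam n *
      (lam ^ k n i * (n.choose (k n i) : ℝ) / (1 + lam) ^ n))) atTop
      (𝓝 (∏ i, (Real.exp (-(1 / 2) * y i ^ 2) / Real.sqrt (2 * Real.pi)))) :=
    tendsto_finsetProd _ fun i _ => tendsto_binomial hlam (hk i)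
  have h3 : Tendsto (fun n => ∏ j ∈ Finset.range m, ∏ b ∈ Finset.range j,
      (scale lam n ^ 2 * (1 + lam) / (lam * ((n : ℝ) - b) / (1 + lam)))) atTop (𝓝 1) := by
    have := tendsto_finsetProd (Finset.range m) fun j _ =>
      tendsto_finsetProd (Finset.range j) fun b _ => tendsto_scale_sq_div hlam b
    simpa using this
  have h4 : (Matrix.vandermonde y).det *
      (∏ i, (Real.exp (-(1 / 2) * y i ^ 2) / Real.sqrt (2 * Real.pi))) * 1 =
      1 / (2 * Real.pi) ^ ((m : ℝ) / 2) * gaussWeight y := by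
    have h5 : (2 * Real.pi) ^ ((m : ℝ) / 2) = Real.sqrt (2 * Real.pi) ^ m := by
      rw [Real.sqrt_eq_rpow, ← Real.rpow_natCast, ← Real.rpow_mul (by positivity)]
      congr 1
      ring
    rw [gaussWeight, Finset.prod_div_distrib, Finset.prod_const, Finset.card_univ,
      Fintype.card_fin, h5]
    ring
  rw [← h4]
  refine ((h1.mul h2).mul h3).congr' ?_
  filter_upwards [eventually_gt_atTop 0] with n hn
  have hs := (scale_pos hlam hn).ne'
  have hl : (1 + lam) ^ n ≠ 0 := by positivity
  have h5 : ∀ j, ∏ b ∈ Finset.range j,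
      (scale lam n ^ 2 * (1 + lam) / (lam * ((n : ℝ) - b) / (1 + lam))) =
      scale lam n ^ j * scale lam n ^ j * (1 + lam) ^ j /
        ∏ b ∈ Finset.range j, (lam * ((n : ℝ) - b) / (1 + lam)) := by
    intro j
    rw [Finset.prod_div_distrib, Finset.prod_const, Finset.card_range, mul_pow, sq, mul_pow]
  rw [krawtchoukWeight, det_vandermonde_rescale m (fun i => (k n i : ℝ)) (centre lam n) _ hs]
  simp only [h5, levelConst]
  generalize (Matrix.vandermonde fun i => ((k n i : ℝ) - centre lam n) / scale lam n).det = V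
  simp only [Finset.prod_div_distrib, Finset.prod_mul_distrib, Finset.prod_const,
    Finset.card_univ, Fintype.card_fin, Finset.card_range, pow_succ (scale lam n)]
  field_simp

/-! ### Weak convergence -/

/-- The particle array, in the indexing of `Agrees`, with the entries of the triangular array
`ζ`. -/
def arrayOf {m : ℕ} (ζ : (Σ ℓ : Fin m, Fin (ℓ.val + 1)) → ℕ) (j i : ℕ) : ℕ :=
  if h : (1 ≤ j ∧ j ≤ m) ∧ i < j then ζ ⟨⟨j - 1, by omega⟩, ⟨i, by simp only; omega⟩⟩ else 0

theorem arrayOf_succ {m : ℕ} (ζ : (Σ ℓ : Fin m, Fin (ℓ.val + 1)) → ℕ) {ℓ i : ℕ} (hℓ : ℓ < m)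
    (hi : i < ℓ + 1) : arrayOf ζ (ℓ + 1) i = ζ ⟨⟨ℓ, hℓ⟩, ⟨i, hi⟩⟩ := by
  rw [arrayOf, dif_pos ⟨⟨by omega, by omega⟩, hi⟩]
  rfl

theorem agrees_arrayOf_iff {n m : ℕ} {ζ : (Σ ℓ : Fin m, Fin (ℓ.val + 1)) → ℕ} {T : Finset Domino} :
    Agrees n m (arrayOf ζ) T ↔ ∀ p, particle n T (p.1 + 1) p.2 = ζ p := by
  constructor
  · rintro h ⟨⟨ℓ, hℓ⟩, ⟨i, hi⟩⟩
    rw [h (ℓ + 1) (by omega) i hi, arrayOf_succ]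
  · intro h j hj i hi
    obtain ⟨ℓ, rfl⟩ : ∃ ℓ, j = ℓ + 1 := ⟨j - 1, by omega⟩
    rw [arrayOf_succ ζ (by omega) hi]
    exact h ⟨⟨ℓ, by omega⟩, ⟨i, hi⟩⟩

theorem eventually_lt_of_tendsto {lam : ℝ} (hlam : 0 < lam) {k k' : ℕ → ℕ} {z z' : ℝ}
    (hk : Tendsto (fun n => ((k n : ℝ) - centre lam n) / scale lam n) atTop (𝓝 z))
    (hk' : Tendsto (fun n => ((k' n : ℝ) - centre lam n) / scale lam n) atTop (𝓝 z'))
    (h : z < z') : ∀ᶠ n in atTop, k n < k' n := by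
  filter_upwards [hk.eventually_lt hk' h, eventually_gt_atTop 0] with n hn h0
  have := (div_lt_div_iff_of_pos_right (scale_pos hlam h0)).1 hn
  exact_mod_cast sub_lt_sub_iff_right _ |>.1 this

theorem interlaceWeight_of_lt {lam : ℝ} {x a b : ℕ} (h1 : a < x) (h2 : x < b) :
    interlaceWeight lam x a b = 1 + lam := by
  rw [interlaceWeight, if_pos ⟨h1.le, h2⟩, if_pos ⟨h1, h2.le⟩]

/-- The local limit of the law of the particles on the first `m` levels. -/
theorem tendsto_cylinderWeight {lam : ℝ} (hlam : 0 < lam) {m : ℕ} {z : TriArray m}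
    (hz : z.Interlaced) (hinj : Function.Injective z)
    {ζ : ℕ → (Σ ℓ : Fin m, Fin (ℓ.val + 1)) → ℕ}
    (hζ : ∀ p, Tendsto (fun n => ((ζ n p : ℝ) - centre lam n) / scale lam n) atTop (𝓝 (z p))) :
    Tendsto (fun n => (∏ j ∈ Finset.range m, scale lam n ^ (j + 1)) *
      (cylinderWeight lam n m (arrayOf (ζ n)) / partitionFunction lam n)) atTop
      (𝓝 (gueCornersDensity m z)) := by
  classical
  rw [gueCornersDensity_eq, if_pos hz]
  have hk : ∀ i : Fin m, Tendsto (fun n => ((arrayOf (ζ n) m i : ℝ) - centre lam n) / scale lam n)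
      atTop (𝓝 (z.lastLevel i)) := by
    intro i
    rcases m with _ | m
    · exact i.elim0
    · simp only [arrayOf_succ _ m.lt_succ_self i.isLt]
      exact hζ _
  have hw : ∀ᶠ n in atTop, ∀ j ∈ Finset.range m, ∀ i ∈ Finset.range j,
      interlaceWeight lam (arrayOf (ζ n) j i) (arrayOf (ζ n) (j + 1) i)
        (arrayOf (ζ n) (j + 1) (i + 1)) = 1 + lam := by
    rw [Finset.eventually_all]
    intro j hj
    rw [Finset.eventually_all]
    intro i hi
    rw [Finset.mem_range] at hi hj
    obtain ⟨ℓ, rfl⟩ : ∃ ℓ, j = ℓ + 1 := ⟨j - 1, by omega⟩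
    simp only [arrayOf_succ _ hj (show i < ℓ + 1 + 1 by omega),
      arrayOf_succ _ hj (show i + 1 < ℓ + 1 + 1 by omega),
      arrayOf_succ _ (show ℓ < m by omega) hi]
    obtain ⟨h1, h2⟩ := hz.2 ℓ i hj hi
    have h1' := h1.lt_of_ne (hinj.ne (by simp))
    have h2' := h2.lt_of_ne (hinj.ne (by simp))
    filter_upwards [eventually_lt_of_tendsto hlam (hζ _) (hζ _) h1',
      eventually_lt_of_tendsto hlam (hζ _) (hζ _) h2'] with n h3 h4
    exact interlaceWeight_of_lt h3 h4
  refine (tendsto_krawtchoukWeight hlam hk).congr' ?_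
  filter_upwards [hw, eventually_ge_atTop m] with n hn hm
  have h1 := cylinderWeight_mul hlam hm (arrayOf (ζ n))
  have h2 : ∏ l ∈ Finset.range m, levelConst lam n l ≠ 0 :=
    Finset.prod_ne_zero_iff.2 fun l hl =>
      (levelConst_pos hlam ((Finset.mem_range.1 hl).le.trans hm)).ne'
  have h3 := (partitionFunction_pos lam n).ne'
  rw [arrayWeight, Finset.prod_congr rfl fun j hj => Finset.prod_congr rfl fun i hi =>
    hn j hj i hi] at h1
  simp only [Finset.prod_const, Finset.card_range] at h1
  congr 1
  rw [div_eq_div_iff h2 h3, h1]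
  ring

open Classical in
theorem biasedMeasure_apply (lam : ℝ) (n : ℕ) (S : Set (Finset Domino)) :
    biasedMeasure lam n S =
      ∑ T ∈ tilings n with T ∈ S, ENNReal.ofReal (weight lam T / partitionFunction lam n) := by
  rw [biasedMeasure, biasedPMF, PMF.toMeasure_ofFinset_apply _ _ S MeasurableSpace.measurableSet_top,
    tsum_eq_sum (s := tilings n), Finset.sum_filter]
  · refine Finset.sum_congr rfl fun T hT => ?_
    rw [Set.indicator_apply, if_pos hT]
  · intro T hT
    rw [Set.indicator_apply, if_neg hT, ite_self]

/-- The cell of the rescaled lattice whose lower corner is `c`. -/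
def latticeBox (lam : ℝ) {m : ℕ} (n : ℕ) (c : TriArray m) : Set (TriArray m) :=
  Set.univ.pi fun p => Set.Ico (c p) (c p + 1 / scale lam n)

theorem volume_latticeBox {lam : ℝ} (hlam : 0 < lam) {m n : ℕ} (hn : 0 < n) (c : TriArray m) :
    ENNReal.ofReal (∏ j ∈ Finset.range m, scale lam n ^ (j + 1)) * volume (latticeBox lam n c) =
      1 := by
  have hs := scale_pos hlam hn
  rw [latticeBox, Real.volume_pi_Ico]
  simp only [add_sub_cancel_left]
  rw [← ENNReal.ofReal_prod_of_nonneg fun _ _ => by positivity,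
    ← ENNReal.ofReal_mul (by positivity), Fintype.prod_sigma]
  simp only [Finset.prod_const, Finset.card_univ, Fintype.card_fin]
  rw [Fin.prod_univ_eq_prod_range (fun j => (1 / scale lam n) ^ (j + 1)),
    ← Finset.prod_mul_distrib, Finset.prod_eq_one, ENNReal.ofReal_one]
  intro j _
  rw [← mul_pow, mul_one_div_cancel hs.ne', one_pow]

theorem measurableSet_latticeBox (lam : ℝ) {m : ℕ} (n : ℕ) (c : TriArray m) :
    MeasurableSet (latticeBox lam n c) :=
  MeasurableSet.univ_pi fun _ => measurableSet_Ico

open Classical in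
/-- The density obtained from the law of the rescaled particles, restricted to `G`, by spreading
each atom uniformly over the lattice cell above it. -/
noncomputable def smearedDensity (lam : ℝ) {m : ℕ} (n : ℕ) (G : Set (TriArray m))
    (z : TriArray m) : ENNReal :=
  ∑ T ∈ tilings n with rescaledParticles lam m n T ∈ G,
    ENNReal.ofReal (weight lam T / partitionFunction lam n) *
      (ENNReal.ofReal (∏ j ∈ Finset.range m, scale lam n ^ (j + 1)) *
        (latticeBox lam n (rescaledParticles lam m n T)).indicator 1 z)

theorem measurable_smearedDensity (lam : ℝ) {m : ℕ} (n : ℕ) (G : Set (TriArray m)) :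
    Measurable (smearedDensity lam n G) := by
  classical
  refine Finset.measurable_sum _ fun T _ => ?_
  exact ((measurable_one.indicator (measurableSet_latticeBox lam n _)).const_mul _).const_mul _

theorem lintegral_smearedDensity {lam : ℝ} (hlam : 0 < lam) {m n : ℕ} (hn : 0 < n)
    (G : Set (TriArray m)) : ∫⁻ z, smearedDensity lam n G z =
      biasedMeasure lam n (rescaledParticles lam m n ⁻¹' G) := by
  classical
  have hm : ∀ T, Measurable ((latticeBox lam n (rescaledParticles lam m n T)).indicator
      (1 : TriArray m → ENNReal)) := fun T =>
    measurable_one.indicator (measurableSet_latticeBox lam n _)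
  simp only [smearedDensity]
  rw [lintegral_finsetSum _ fun T _ => ((hm T).const_mul _).const_mul _, biasedMeasure_apply]
  refine Finset.sum_congr rfl fun T _ => ?_
  rw [lintegral_const_mul _ ((hm T).const_mul _), lintegral_const_mul _ (hm T),
    lintegral_indicator_one (measurableSet_latticeBox lam n _), volume_latticeBox hlam hn, mul_one]

/-- The lattice point below `z`. -/
noncomputable def latticeFloor (lam : ℝ) {m : ℕ} (n : ℕ) (z : TriArray m)
    (p : Σ ℓ : Fin m, Fin (ℓ.val + 1)) : ℕ :=
  ⌊centre lam n + scale lam n * z p⌋₊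

theorem tendsto_latticeFloor {lam : ℝ} (hlam : 0 < lam) {m : ℕ} (z : TriArray m)
    (p : Σ ℓ : Fin m, Fin (ℓ.val + 1)) :
    Tendsto (fun n => ((latticeFloor lam n z p : ℝ) - centre lam n) / scale lam n) atTop
      (𝓝 (z p)) := by
  have h1 : Tendsto (fun n => z p - (scale lam n)⁻¹) atTop (𝓝 (z p)) := by
    simpa using (tendsto_scale hlam).inv_tendsto_atTop.const_sub (z p)
  refine tendsto_of_tendsto_of_tendsto_of_le_of_le' h1 tendsto_const_nhds ?_ ?_
  · filter_upwards [eventually_gt_atTop 0] with n hn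
    have hs := scale_pos hlam hn
    have := Nat.lt_floor_add_one (centre lam n + scale lam n * z p)
    rw [le_div_iff₀ hs, sub_mul, inv_mul_cancel₀ hs.ne', latticeFloor]
    linarith
  · filter_upwards [eventually_gt_atTop 0,
      (tendsto_centre_add hlam (z p)).eventually_ge_atTop 0] with n hn h0
    have := Nat.floor_le h0
    rw [div_le_iff₀ (scale_pos hlam hn), latticeFloor]
    linarith

/-- Off the null set of arrays with coinciding entries, the limiting density is at most the lower
limit of the smeared densities. -/
theorem le_liminf_smearedDensity {lam : ℝ} (hlam : 0 < lam) {m : ℕ} {G : Set (TriArray m)}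
    (hG : IsOpen G) {z : TriArray m} (hinj : Function.Injective z) :
    G.indicator (fun z => ENNReal.ofReal (gueCornersDensity m z)) z ≤
      liminf (fun n => smearedDensity lam n G z) atTop := by
  classical
  by_cases hzG : z ∈ G
  swap
  · rw [Set.indicator_of_notMem hzG]
    exact zero_le
  rw [Set.indicator_of_mem hzG]
  by_cases hz : z.Interlaced
  swap
  · rw [gueCornersDensity_eq, if_neg hz, ENNReal.ofReal_zero]
    exact zero_le
  have hζ := tendsto_latticeFloor hlam z
  have hlim := ENNReal.tendsto_ofReal (tendsto_cylinderWeight hlam hz hinj hζ)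
  have hmem : ∀ᶠ n in atTop,
      (fun p => ((latticeFloor lam n z p : ℝ) - centre lam n) / scale lam n) ∈ G :=
    (tendsto_pi_nhds.2 hζ).eventually (hG.mem_nhds hzG)
  have hpos : ∀ᶠ n in atTop, ∀ p, 0 ≤ centre lam n + scale lam n * z p :=
    eventually_all.2 fun p => (tendsto_centre_add hlam (z p)).eventually_ge_atTop 0
  rw [← hlim.liminf_eq]
  refine liminf_le_liminf ?_
  filter_upwards [hmem, hpos, eventually_gt_atTop 0] with n h1 h2 hn
  have hs := scale_pos hlam hn
  -- The tilings whose particles are at the lattice point below `z` contribute the full height of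
  -- their atom to the density at `z`.
  have key : ∀ T, Agrees n m (arrayOf (latticeFloor lam n z)) T →
      rescaledParticles lam m n T ∈ G ∧ z ∈ latticeBox lam n (rescaledParticles lam m n T) := by
    intro T hT
    have hT' : rescaledParticles lam m n T =
        fun p => ((latticeFloor lam n z p : ℝ) - centre lam n) / scale lam n := by
      funext p
      rw [← agrees_arrayOf_iff.1 hT p]
      rfl
    rw [hT']
    refine ⟨h1, fun p _ => ⟨?_, ?_⟩⟩
    · have := Nat.floor_le (h2 p)
      rw [div_le_iff₀ hs, latticeFloor]
      linarith
    · have := Nat.lt_floor_add_one (centre lam n + scale lam n * z p)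
      rw [← add_div, lt_div_iff₀ hs, latticeFloor]
      linarith
  have hZ := partitionFunction_pos lam n
  rw [cylinderWeight, Finset.sum_div, ENNReal.ofReal_mul (by positivity),
    ENNReal.ofReal_sum_of_nonneg fun T _ => div_nonneg (weight_nonneg lam T) hZ.le,
    Finset.mul_sum, smearedDensity]
  refine le_trans (Finset.sum_le_sum fun T hT => ?_) (Finset.sum_le_sum_of_subset fun T hT => ?_)
  · rw [Set.indicator_of_mem (key T (Finset.mem_filter.1 hT).2).2, Pi.one_apply, mul_one, mul_comm]
  · rw [Finset.mem_filter] at hT ⊢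
    exact ⟨hT.1, (key T hT.2).1⟩

end AztecDiamond

/-- Two different entries coincide only on a proper linear subspace. -/
theorem ae_injective_triArray (m : ℕ) : ∀ᵐ z : TriArray m, Function.Injective z := by
  have h : ∀ p q : Σ ℓ : Fin m, Fin (ℓ.val + 1), p ≠ q → ∀ᵐ z : TriArray m, z p ≠ z q := by
    intro p q hpq
    let φ : TriArray m →ₗ[ℝ] ℝ := (LinearMap.proj p : TriArray m →ₗ[ℝ] ℝ) - LinearMap.proj q
    have hφ : LinearMap.ker φ ≠ ⊤ := by
      intro h
      have h1 : φ (Pi.single p 1) = 0 := LinearMap.mem_ker.1 (h ▸ Submodule.mem_top)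
      simp [φ, hpq.symm] at h1
    refine measure_mono_null (fun z hz => ?_)
      (Measure.addHaar_submodule (volume : Measure (TriArray m)) (LinearMap.ker φ) hφ)
    simpa [φ, sub_eq_zero] using hz
  have h' : ∀ᵐ z : TriArray m, ∀ p q, p ≠ q → z p ≠ z q :=
    ae_all_iff.2 fun p => ae_all_iff.2 fun q => by
      by_cases hpq : p = q
      · exact Eventually.of_forall fun z hne => absurd hpq hne
      · exact (h p q hpq).mono fun z hz _ => hz
  exact h'.mono fun z hz p q hpq => by_contra fun hne => hz p q hne hpq

/-- The lower bound on open sets in the portmanteau theorem, by Fatou's lemma. -/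
theorem gueCorners_le_liminf {lam : ℝ} (hlam : 0 < lam) {m : ℕ} {G : Set (TriArray m)}
    (hG : IsOpen G) : gueCorners m G ≤
      liminf (fun n => AztecDiamond.biasedMeasure lam n (rescaledParticles lam m n ⁻¹' G)) atTop := by
  rw [gueCorners, withDensity_apply _ hG.measurableSet, ← lintegral_indicator hG.measurableSet]
  calc ∫⁻ z, G.indicator (fun z => ENNReal.ofReal (gueCornersDensity m z)) z
      ≤ ∫⁻ z, liminf (fun n => AztecDiamond.smearedDensity lam n G z) atTop :=
        lintegral_mono_ae ((ae_injective_triArray m).mono fun z hz =>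
          AztecDiamond.le_liminf_smearedDensity hlam hG hz)
    _ ≤ liminf (fun n => ∫⁻ z, AztecDiamond.smearedDensity lam n G z) atTop :=
        lintegral_liminf_le fun n => AztecDiamond.measurable_smearedDensity lam n G
    _ = _ := liminf_congr ((eventually_gt_atTop 0).mono fun n hn =>
        AztecDiamond.lintegral_smearedDensity hlam hn G)

theorem mainTheorem2 (lam : ℝ) (hlam : 0 < lam) (m : ℕ) :
    ∃ _ : IsProbabilityMeasure (gueCorners m),
      TendstoInDistribution (fun n : ℕ => rescaledParticles lam m n) atTop
        (id : TriArray m → TriArray m)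
        (fun n : ℕ => AztecDiamond.biasedMeasure lam n) (gueCorners m) := by
  have hmeas : ∀ n, Measurable (rescaledParticles lam m n) := fun n => measurable_from_top
  have hprob := isProbabilityMeasure_gueCorners m
  refine ⟨hprob, fun n => (hmeas n).aemeasurable, aemeasurable_id, ?_⟩
  refine tendsto_of_forall_isOpen_le_liminf_nat' fun G hG => ?_
  simp only [ProbabilityMeasure.coe_mk, Measure.map_id]
  refine (gueCorners_le_liminf hlam hG).trans_eq (congrArg (liminf · atTop) (funext fun n => ?_))
  rw [Measure.map_apply (hmeas n) hG.measurableSet]
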